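/- Let $L^2_+$ be the Hardy space of functions in $L^2(\mathbb S^1)$ (with the measure $d\theta/2\pi$) whose Fourier coefficients of negative index vanish, $\Pi:L^2\to L^2_+$ the orthogonal (Szegő) projector, $(f|g)=\int f\bar g\,\frac{d\theta}{2\pi}$, and $H^s_+=H^s(\mathbb S^1)\cap L^2_+$. Let $\alpha\in\mathbb R$, $s>\frac12$, and let $u\in C(\mathbb R;H^s_+)$ be a solution of $$i\partial_t u=\Pi(|u|^2u)+\alpha(u|1).$$ For $u\in H^s_+$ put $H_u(h)=\Pi(u\bar h)$, $T_z(h)=zh$, $K_u=T_z^*H_u$ on $L^2_+$, and for $\tau\ge 0$ put $E_u(\tau)=\ker(H_u^2-\tau^2 I)$, $F_u(\tau)=\ker(K_u^2-\tau^2 I)$, $\Sigma_H(u)=\{\tau>0: u\not\perp E_u(\tau)\}$, $\Sigma_K(u)=\{\tau\ge0: u\not\perp F_u(\tau)\}$. Let $\sigma_k>0$, let $u'_k(t)$ be the orthogonal projection of $u(t)$ onto $F_{u(t)}(\sigma_k)$, and let $T_c$ be the set of times $t$ of crossing at $\sigma_k$, that is, $\sigma_k\in\Sigma_H(u(t))$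 and $\dim E_{u(t)}(\sigma_k)\ge2$. A finite Blaschke product of degree $d$ is a function $e^{-i\psi}P(z)/D(z)$ with $\psi\in\mathbb R/2\pi\mathbb Z$, $P$ a monic polynomial of degree $d$ with all its roots in the open unit disc, and $D(z)=z^d\,\overline P(1/z)$. For every $t$ with $\sigma_k\in\Sigma_K(u(t))$ there is exactly one finite Blaschke product $\Psi_k(t)$ with $$K_{u(t)}u'_k(t)=\sigma_k\Psi_k(t)u'_k(t),$$ and its degree is $\dim F_{u(t)}(\sigma_k)-1$. Moreover: 1. Let $\Omega\subset\mathbb R$ be an open interval with $\Omega\cap T_c=\emptyset$ and $\sigma_k\in\Sigma_K(u(t))$ for some $t\in\Omega$. Then $\sigma_k\in\Sigma_K(u(t))$ for all $t\in\Omega$, and for every $t_0\in\Omega$ (for example $t_0=0$, if $0\in\Omega$) there is a function $\psi_k:\Omega\to\mathbb R$ such that $\Psi_k(t)=e^{i\psi_k(t)}\Psi_k(t_0)$ for all $t\in\Omega$. 2. The zeros of $\Psi_k(t)$, counted with multiplicity, are the same at all times $t\in\mathbb R$ at which $\Psi_k(t)$ is defined, that is, at which $\sigma_k\in\Sigma_K(u(t))$;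 in particular they are the same before and after a crossing. -/

import Mathlib

open MeasureTheory Complex Filter Topology
open scoped ENNReal Real InnerProductSpace ComplexConjugate

namespace AlphaSzego

noncomputable section

/-! ### Functions on the circle, the Hardy space, the Szegő projector -/

instance twoPiPos : Fact (0 < 2 * π) := ⟨Real.two_pi_pos⟩

/-- The circle, parametrised by the angle `θ ∈ ℝ / 2πℤ`. -/
abbrev Torus : Type := AddCircle (2 * π)

/-- The normalised measure `dθ / 2π` on the circle. -/
abbrev circleMeasure : Measure Torus := AddCircle.haarAddCircle

/-- The Hilbert space `L²` of the circle, with respect to `dθ / 2π`. -/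
abbrev L2 : Type := Lp ℂ 2 circleMeasure

/-- The class in `L²` of a continuous function. -/
def toL2 : C(Torus, ℂ) →L[ℂ] L2 := ContinuousMap.toLp 2 circleMeasure ℂ

/-- The `L²` functions all of whose Fourier coefficients of negative index vanish. -/
def hardySubmodule : Submodule ℂ L2 where
  carrier := {f | ∀ n : ℤ, n < 0 → fourierCoeff f n = 0}
  zero_mem' := by
    intro n _
    rw [← fourierBasis_repr]
    simp
  add_mem' := by
    intro f g hf hg n hn
    have h1 := hf n hn
    have h2 := hg n hn
    rw [← fourierBasis_repr] at h1 h2 ⊢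
    simp [h1, h2]
  smul_mem' := by
    intro c f hf n hn
    have h1 := hf n hn
    rw [← fourierBasis_repr] at h1 ⊢
    simp [h1]

lemma isClosed_hardySubmodule : IsClosed (hardySubmodule : Set L2) := by
  have h : (hardySubmodule : Set L2)
      = ⋂ n : ℤ, ⋂ _ : n < 0, {f : L2 | inner ℂ (fourierBasis (T := 2 * π) n) f = 0} := by
    ext f
    simp only [Set.mem_iInter, Set.mem_ofPred_eq]
    constructor
    · intro hf n hn
      rw [← HilbertBasis.repr_apply_apply, fourierBasis_repr]
      exact hf n hn
    · intro hf n hn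
      have := hf n hn
      rwa [← HilbertBasis.repr_apply_apply, fourierBasis_repr] at this
  rw [h]
  refine isClosed_iInter fun n => isClosed_iInter fun _ => ?_
  exact isClosed_eq (by fun_prop) continuous_const

/-- The Hardy space `L²₊`. -/
abbrev Hardy : Type := hardySubmodule

instance completeHardy : CompleteSpace Hardy := isClosed_hardySubmodule.completeSpace_coe

/-- The Szegő projector `Π`, the orthogonal projection of `L²` onto `L²₊`. -/
def szego : L2 →L[ℂ] Hardy := hardySubmodule.orthogonalProjectionOnto

/-- A continuous function as an element of `L²₊`.  For a function without Fourier modes of negative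
index the projector `Π` does nothing. -/
def toHardy : C(Torus, ℂ) →L[ℂ] Hardy := szego ∘L toL2

/-! ### Hankel and Toeplitz operators -/

/-- Multiplication `h ↦ b h` on `L²` by a continuous function `b`. -/
def mulL2 (b : C(Torus, ℂ)) : L2 →L[ℂ] L2 :=
  (ContinuousLinearMap.mul ℂ ℂ).holderL circleMeasure ∞ 2 2
    (ContinuousMap.toLp ∞ circleMeasure ℂ b)

/-- Complex conjugation `h ↦ h̄` on `L²`. -/
def conjL2 : L2 →SL[starRingEnd ℂ] L2 :=
  LinearMap.mkContinuous
    { toFun := fun f => star f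
      map_add' := by
        intro f g
        apply Lp.ext
        filter_upwards [Lp.coeFn_star (f + g), Lp.coeFn_add f g, Lp.coeFn_star f,
          Lp.coeFn_star g, Lp.coeFn_add (star f) (star g)] with x h1 h2 h3 h4 h5
        change (star (f + g) : L2) x = (star f + star g : L2) x
        rw [h1, h5, Pi.star_apply, h2, Pi.add_apply, Pi.add_apply, h3, h4]
        simp
      map_smul' := by
        intro c f
        apply Lp.ext
        filter_upwards [Lp.coeFn_star (c • f), Lp.coeFn_smul c f, Lp.coeFn_star f,
          Lp.coeFn_smul (conj c) (star f)] with x h1 h2 h3 h4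
        simp [h1, h2, h3, h4] }
    1 (by
      intro f
      rw [one_mul]
      refine Lp.norm_le_norm_of_ae_le ?_
      filter_upwards [Lp.coeFn_star f] with x h
      simp [h])

/-- The antilinear Hankel operator `H_u h = Π(u h̄)` on `L²₊`. -/
def hankel (u : C(Torus, ℂ)) : Hardy →SL[starRingEnd ℂ] Hardy :=
  (szego ∘L mulL2 u).comp (conjL2.comp hardySubmodule.subtypeL)

/-- The Toeplitz operator `T_b h = Π(b h)` on `L²₊`. -/
def toeplitz (b : C(Torus, ℂ)) : Hardy →L[ℂ] Hardy :=
  szego ∘L mulL2 b ∘L hardySubmodule.subtypeL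

/-- The shifted Hankel operator `K_u = T_z^* H_u`, where `z = e^{iθ}`. -/
def shiftedHankel (u : C(Torus, ℂ)) : Hardy →SL[starRingEnd ℂ] Hardy :=
  (ContinuousLinearMap.adjoint (toeplitz (fourier 1))).comp (hankel u)

/-- `E_u(τ) = ker (H_u² - τ² I)`. -/
def eigenH (u : C(Torus, ℂ)) (τ : ℝ) : Submodule ℂ Hardy :=
  ((hankel u).comp (hankel u) - ((τ : ℂ) ^ 2) • ContinuousLinearMap.id ℂ Hardy).ker

/-- `F_u(τ) = ker (K_u² - τ² I)`. -/
def eigenK (u : C(Torus, ℂ)) (τ : ℝ) : Submodule ℂ Hardy :=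
  ((shiftedHankel u).comp (shiftedHankel u)
    - ((τ : ℂ) ^ 2) • ContinuousLinearMap.id ℂ Hardy).ker

instance completeEigenK (u : C(Torus, ℂ)) (τ : ℝ) : CompleteSpace (eigenK u τ) := by
  unfold eigenK
  infer_instance

/-- `Σ_H(u)`: the `τ > 0` such that `u` is not orthogonal to `E_u(τ)`. -/
def SigmaH (u : C(Torus, ℂ)) : Set ℝ := {τ | 0 < τ ∧ toHardy u ∉ (eigenH u τ)ᗮ}

/-- `Σ_K(u)`: the `τ ≥ 0` such that `u` is not orthogonal to `F_u(τ)`. -/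
def SigmaK (u : C(Torus, ℂ)) : Set ℝ := {τ | 0 ≤ τ ∧ toHardy u ∉ (eigenK u τ)ᗮ}

/-- `u'_τ`, the orthogonal projection of `u` onto `F_u(τ)`. -/
def projK (u : C(Torus, ℂ)) (τ : ℝ) : Hardy := (eigenK u τ).starProjection (toHardy u)

/-! ### Finite Blaschke products -/

/-- A finite Blaschke product `e^{-iψ} P(z) / D(z)`, given by its angle `ψ` and by the monic
polynomial `P`, all of whose roots lie in the open unit disc. -/
structure BlaschkeProduct where
  angle : Real.Angle
  P : Polynomial ℂ
  monic : P.Monic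
  norm_lt_one : ∀ a ∈ P.roots, ‖a‖ < 1

namespace BlaschkeProduct

def degree (Ψ : BlaschkeProduct) : ℕ := Ψ.P.natDegree

/-- The normalised denominator `D(z) = z^k P̄(1/z)`, where `k` is the degree. -/
def D (Ψ : BlaschkeProduct) : Polynomial ℂ := (Ψ.P.map (starRingEnd ℂ)).reverse

/-- The value at a point. `D` has no zero in the closed unit disc. -/
def eval (Ψ : BlaschkeProduct) (z : ℂ) : ℂ :=
  ((-Ψ.angle).toCircle : ℂ) * (Ψ.P.eval z / Ψ.D.eval z)

/-- The zeros, with multiplicity. -/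
def zeros (Ψ : BlaschkeProduct) : Multiset ℂ := Ψ.P.roots

end BlaschkeProduct

/-- `K_u u'_σ = σ Ψ u'_σ`, as an identity in `L²` of the circle. -/
def IsBlaschkeFactor (u : C(Torus, ℂ)) (σ : ℝ) (Ψ : BlaschkeProduct) : Prop :=
  ((shiftedHankel u (projK u σ) : Hardy) : L2)
    =ᵐ[circleMeasure] fun x => (σ : ℂ) * Ψ.eval (fourier 1 x) * ((projK u σ : Hardy) : L2) x

/-! ### The equation -/

/-- The square of the norm of `H^s`, with value `∞` outside of `H^s`. -/
def sobolevNormSq (s : ℝ) (f : C(Torus, ℂ)) : ℝ≥0∞ :=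
  ∑' n : ℤ, ENNReal.ofReal ((1 + (n : ℝ) ^ 2) ^ s * ‖fourierCoeff f n‖ ^ 2)

/-- The space `H^s_+` for `s > 1/2`; its elements are identified with their continuous
representatives. -/
def SobolevPlus (s : ℝ) : Set C(Torus, ℂ) :=
  {f | (∀ n : ℤ, n < 0 → fourierCoeff f n = 0) ∧ sobolevNormSq s f < ∞}

/-- `u ∈ C(ℝ; H^s_+)` solves `i ∂_t u = Π(|u|² u) + α (u|1)`; the time derivative is taken in `L²`.
Here `(u|1)` is the mean value of `u`, and it stands for a constant function. -/
structure IsSolution (α s : ℝ) (u : ℝ → C(Torus, ℂ)) : Prop where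
  mem : ∀ t, u t ∈ SobolevPlus s
  continuous : ∀ t₀, Tendsto (fun t => sobolevNormSq s (u t - u t₀)) (𝓝 t₀) (𝓝 0)
  hasDerivAt : ∀ t, ∃ v : Hardy, HasDerivAt (fun t' => toHardy (u t')) v t ∧
    I • v = toHardy (star (u t) * u t * u t) +
      ((α : ℂ) * inner ℂ (toHardy 1) (toHardy (u t))) • toHardy 1

/-- The times of crossing at `σ`: `σ` is a dominant eigenvalue of `H_{u(t)}` of multiplicity
at least `2`. -/
def crossingTimes (u : ℝ → C(Torus, ℂ)) (σ : ℝ) : Set ℝ :=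
  {t | σ ∈ SigmaH (u t) ∧ 2 ≤ Module.finrank ℂ (eigenH (u t) σ)}

end

end AlphaSzego

namespace AlphaSzego

/-! ### Multiplication and conjugation on `L²` -/

/-! The proof has a static part, at one time, and a dynamic part, along a Lax flow.

Static part. From `K_u² = H_u² - ⟨u, ·⟩ u` it follows that if `u' = u'_σ ≠ 0`, then `E_u(σ) = F_u(σ)
∩ u^⊥`; this space is orthogonal to `1` and the backward shift sends it into `F_u(σ)`. Hence
`F_u(σ)` has a basis `w, z w, …, z^n w` whose members after the first are orthogonal to `u`
(`exists_isChain`). The operator `K_u` reverses it: `K_u (z^i w) = c z^(n-i) w` with `|c| = σ`.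
Write `u' = Q(z) w` with `deg Q ≤ n`. Orthogonality of `u'` to `z w, …, z^n w` puts the roots of `Q`
outside the closed disc, and `K_u u' = c Q*(z) w`, where `Q*` is the conjugate reversal of `Q` in
degree `n`. So `Ψ` is a unimodular multiple of the normalised quotient `Q*/Q`, and its zeros depend
only on `Q` up to a scalar.

Dynamic part. `K_u` does not see the zero mode of `u`, so the `α` term drops out and `K_u` obeys a
Lax equation with the skew-adjoint operator `C_u = -i T_{|u|²} + (i/2) K_u²`. The flow of `C_u` is
isometric and carries `F_u(σ)` at one time onto `F_u(σ)` at another. Joint orthogonality to `1` and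
`u` is preserved in it (a Grönwall argument for two scalars), and on such vectors `C_u` commutes
with the backward shift. Thus chains go to chains with the same Gram matrix
(`exists_isChain_transport`). Since `u'` is, up to a scalar, the only vector of `F_u(σ)` orthogonal
to `z w, …, z^n w`, the Gram matrix determines `Q` up to a scalar. The transport needs `u' ≠ 0` only
at its starting time, so it passes through crossings.

Finally `dim F_u(σ)` is constant, and `u ⊥ F_u(σ) ≠ 0` can happen only at a crossing; hence `u'`
does not vanish away from crossings. -/

lemma coeFn_toL2 (b : C(Torus, ℂ)) : (toL2 b : L2) =ᵐ[circleMeasure] b :=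
  ContinuousMap.coeFn_toLp (p := 2) (𝕜 := ℂ) circleMeasure b

lemma coeFn_mulL2 (b : C(Torus, ℂ)) (f : L2) :
    (mulL2 b f : L2) =ᵐ[circleMeasure] fun x => b x * f x := by
  have h1 : (mulL2 b f : L2) =ᵐ[circleMeasure] fun x =>
      (ContinuousMap.toLp ∞ circleMeasure ℂ b : Lp ℂ ∞ circleMeasure) x * f x :=
    (ContinuousLinearMap.mul ℂ ℂ).coeFn_holder (r := 2)
      (ContinuousMap.toLp ∞ circleMeasure ℂ b) f
  filter_upwards [h1, ContinuousMap.coeFn_toLp (p := ∞) (𝕜 := ℂ) circleMeasure b] with x h h'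
  rw [h, h']

lemma coeFn_conjL2 (f : L2) : (conjL2 f : L2) =ᵐ[circleMeasure] fun x => conj (f x) := by
  filter_upwards [Lp.coeFn_star f] with x h
  exact h

lemma mulL2_mul (a b : C(Torus, ℂ)) (f : L2) : mulL2 (a * b) f = mulL2 a (mulL2 b f) := by
  apply Lp.ext
  filter_upwards [coeFn_mulL2 (a * b) f, coeFn_mulL2 a (mulL2 b f), coeFn_mulL2 b f] with x h1 h2 h3
  rw [h1, h2, h3, ContinuousMap.mul_apply, mul_assoc]

lemma mulL2_toL2 (a b : C(Torus, ℂ)) : mulL2 a (toL2 b) = toL2 (a * b) := by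
  apply Lp.ext
  filter_upwards [coeFn_mulL2 a (toL2 b), coeFn_toL2 b, coeFn_toL2 (a * b)] with x h1 h2 h3
  rw [h1, h2, h3, ContinuousMap.mul_apply]

lemma mulL2_add (a b : C(Torus, ℂ)) (f : L2) : mulL2 (a + b) f = mulL2 a f + mulL2 b f := by
  simp [mulL2]

lemma mulL2_smul (c : ℂ) (b : C(Torus, ℂ)) (f : L2) : mulL2 (c • b) f = c • mulL2 b f := by
  simp [mulL2]

lemma conjL2_mulL2 (a : C(Torus, ℂ)) (f : L2) : conjL2 (mulL2 a f) = mulL2 (star a) (conjL2 f) := by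
  apply Lp.ext
  filter_upwards [coeFn_mulL2 a f, coeFn_conjL2 (mulL2 a f), coeFn_mulL2 (star a) (conjL2 f),
    coeFn_conjL2 f] with x h1 h2 h3 h4
  rw [h2, h3, h1, h4, map_mul]
  rfl

lemma conjL2_conjL2 (f : L2) : conjL2 (conjL2 f) = f := by
  apply Lp.ext
  filter_upwards [coeFn_conjL2 (conjL2 f), coeFn_conjL2 f] with x h1 h2
  rw [h1, h2, conj_conj]

lemma conjL2_toL2 (a : C(Torus, ℂ)) : conjL2 (toL2 a) = toL2 (star a) := by
  apply Lp.ext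
  filter_upwards [coeFn_conjL2 (toL2 a), coeFn_toL2 a, coeFn_toL2 (star a)] with x h1 h2 h3
  rw [h1, h2, h3]
  rfl

lemma inner_conjL2 (f g : L2) : inner ℂ (conjL2 f) (conjL2 g) = inner ℂ g f := by
  rw [MeasureTheory.L2.inner_def, MeasureTheory.L2.inner_def]
  apply integral_congr_ae
  filter_upwards [coeFn_conjL2 f, coeFn_conjL2 g] with x h1 h2
  rw [h1, h2]
  simp [mul_comm]

lemma inner_mulL2_left (a : C(Torus, ℂ)) (f g : L2) :
    inner ℂ (mulL2 a f) g = inner ℂ f (mulL2 (star a) g) := by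
  rw [MeasureTheory.L2.inner_def, MeasureTheory.L2.inner_def]
  apply integral_congr_ae
  filter_upwards [coeFn_mulL2 a f, coeFn_mulL2 (star a) g] with x h1 h2
  rw [h1, h2]
  simp [ContinuousMap.star_apply]
  ring

lemma inner_mulL2_conjL2 (a : C(Torus, ℂ)) (f g : L2) :
    inner ℂ g (mulL2 a (conjL2 f)) = inner ℂ f (mulL2 a (conjL2 g)) := by
  rw [← inner_conjL2 _ f, conjL2_mulL2, inner_mulL2_left, conjL2_conjL2, star_star,
    ← inner_conjL2, ← inner_conjL2, conjL2_conjL2]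

lemma norm_conjL2 (f : L2) : ‖conjL2 f‖ = ‖f‖ := by
  rw [← sq_eq_sq₀ (norm_nonneg _) (norm_nonneg _), @norm_sq_eq_re_inner ℂ, @norm_sq_eq_re_inner ℂ,
    inner_conjL2]

lemma norm_mulL2_le (a : C(Torus, ℂ)) (f : L2) : ‖mulL2 a f‖ ≤ ‖a‖ * ‖f‖ := by
  refine Lp.norm_le_mul_norm_of_ae_le_mul ?_
  filter_upwards [coeFn_mulL2 a f] with x h
  rw [h, norm_mul]
  gcongr
  exact a.norm_coe_le_norm x

/-! ### The Hardy space -/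

/-- The inner product of the Hardy space, as found through its inner product space structure. -/
noncomputable instance innerHardy : Inner ℂ Hardy := InnerProductSpace.toInner

lemma Hardy.inner_smul_right (f g : Hardy) (c : ℂ) : inner ℂ f (c • g) = c * inner ℂ f g :=
  _root_.inner_smul_right f g c

lemma Hardy.inner_smul_left (f g : Hardy) (c : ℂ) : inner ℂ (c • f) g = conj c * inner ℂ f g :=
  _root_.inner_smul_left f g c


lemma inner_fourier (n : ℤ) (f : L2) : inner ℂ (toL2 (fourier n)) f = fourierCoeff f n := by
  rw [← fourierBasis_repr, HilbertBasis.repr_apply_apply, coe_fourierBasis]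
  rfl

lemma fourierCoeff_toL2 (n : ℤ) (f : C(Torus, ℂ)) : fourierCoeff (toL2 f) n = fourierCoeff f n :=
  fourierCoeff_toLp f n

lemma mem_hardy_iff (f : L2) :
    f ∈ hardySubmodule ↔ ∀ n : ℤ, n < 0 → inner ℂ (toL2 (fourier n)) f = 0 := by
  simp_rw [inner_fourier]
  rfl

lemma fourier_mul_fourier (m n : ℤ) :
    (fourier m * fourier n : C(Torus, ℂ)) = fourier (m + n) := by
  ext x
  simp

lemma star_fourier (n : ℤ) : (star (fourier n) : C(Torus, ℂ)) = fourier (-n) := by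
  ext x
  simp

lemma inner_fourier_fourier (m n : ℤ) :
    inner ℂ (toL2 (fourier m)) (toL2 (fourier n)) = if m = n then (1 : ℂ) else 0 :=
  (orthonormal_iff_ite.1 (orthonormal_fourier (T := 2 * π))) m n

lemma fourier_mem_hardy {n : ℤ} (hn : 0 ≤ n) : toL2 (fourier n) ∈ hardySubmodule := by
  rw [mem_hardy_iff]
  intro m hm
  rw [inner_fourier_fourier, if_neg (by omega)]

lemma hasSum_inner (f g : L2) :
    HasSum (fun n : ℤ => inner ℂ f (toL2 (fourier n)) * inner ℂ (toL2 (fourier n)) g)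
      (inner ℂ f g) := by
  have := (fourierBasis (T := 2 * π)).hasSum_inner_mul_inner f g
  rw [coe_fourierBasis] at this
  exact this

lemma inner_eq_zero_of_modes {f g : L2}
    (h : ∀ n : ℤ, inner ℂ (toL2 (fourier n)) f = 0 ∨ inner ℂ (toL2 (fourier n)) g = 0) :
    inner ℂ f g = 0 := by
  refine (hasSum_inner f g).unique ?_
  convert hasSum_zero with n
  rcases h n with h | h
  · rw [← inner_conj_symm, h]; simp
  · rw [h, mul_zero]

lemma eq_of_modes {f g : L2}
    (h : ∀ n : ℤ, inner ℂ (toL2 (fourier n)) f = inner ℂ (toL2 (fourier n)) g) : f = g := by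
  rw [← sub_eq_zero, ← inner_self_eq_zero (𝕜 := ℂ)]
  refine inner_eq_zero_of_modes fun n => Or.inl ?_
  rw [inner_sub_right, h, sub_self]

lemma inner_szego (g : Hardy) (f : L2) : inner ℂ g (szego f) = inner ℂ (g : L2) f :=
  Submodule.inner_orthogonalProjectionOnto_eq_of_mem_left g f

lemma norm_szego_le (f : L2) : ‖szego f‖ ≤ ‖f‖ :=
  hardySubmodule.norm_orthogonalProjectionOnto_apply_le f

lemma szego_coe (f : Hardy) : szego f = f :=
  hardySubmodule.orthogonalProjectionOnto_mem_subspace_eq_self f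

lemma coe_szego_of_mem {f : L2} (hf : f ∈ hardySubmodule) : ((szego f : Hardy) : L2) = f :=
  congrArg Subtype.val (szego_coe ⟨f, hf⟩)

/-- The monomial `z ^ n` in the Hardy space. -/
noncomputable def mode (n : ℕ) : Hardy := ⟨toL2 (fourier n), fourier_mem_hardy (by positivity)⟩

lemma Hardy.eq_of_modes {f g : Hardy} (h : ∀ n : ℕ, inner ℂ (mode n) f = inner ℂ (mode n) g) :
    f = g := by
  apply Subtype.ext
  apply AlphaSzego.eq_of_modes
  intro n
  rcases lt_or_ge n 0 with hn | hn
  · rw [(mem_hardy_iff _).1 f.2 n hn, (mem_hardy_iff _).1 g.2 n hn]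
  · lift n to ℕ using hn
    exact h n

lemma Hardy.ext_inner {f g : Hardy} (h : ∀ k : Hardy, inner ℂ k f = inner ℂ k g) : f = g :=
  Hardy.eq_of_modes fun _ => h _

lemma toHardy_one : toHardy 1 = mode 0 := by
  have : (1 : C(Torus, ℂ)) = fourier 0 := by ext x; simp
  rw [this]
  exact szego_coe (mode 0)

/-- For `n < 0 ≤ m` the symbol has no mode `n - m`, so by Parseval no negative mode is produced. -/
lemma mulL2_mem_hardy {u : C(Torus, ℂ)} (hu : toL2 u ∈ hardySubmodule) {f : L2}
    (hf : f ∈ hardySubmodule) : mulL2 u f ∈ hardySubmodule := by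
  rw [mem_hardy_iff]
  intro n hn
  rw [← inner_conj_symm, inner_mulL2_left, inner_eq_zero_of_modes, map_zero]
  intro m
  rcases lt_or_ge m 0 with hm | hm
  · exact Or.inl ((mem_hardy_iff _).1 hf m hm)
  · right
    rw [← inner_mulL2_left, mulL2_toL2, mul_comm u, ← mulL2_toL2, inner_mulL2_left, mulL2_toL2,
      star_fourier, fourier_mul_fourier, ← inner_conj_symm,
      (mem_hardy_iff _).1 hu _ (by omega), map_zero]

lemma conjL2_mem_hardy {r : L2} (hr : ∀ g ∈ hardySubmodule, inner ℂ g r = 0) :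
    conjL2 r ∈ hardySubmodule := by
  rw [mem_hardy_iff]
  intro n hn
  rw [← conjL2_conjL2 (toL2 _), inner_conjL2, conjL2_toL2, star_fourier, ← inner_conj_symm,
    hr _ (fourier_mem_hardy (by omega)), map_zero]

/-! ### Shift, Hankel and Toeplitz operators -/

/-- The shift `h ↦ z h` on the Hardy space. -/
noncomputable def shift : Hardy →L[ℂ] Hardy := toeplitz (fourier 1)

/-- The backward shift, the adjoint of the shift. -/
noncomputable def bshift : Hardy →L[ℂ] Hardy := ContinuousLinearMap.adjoint shift

lemma inner_toeplitz (b : C(Torus, ℂ)) (f g : Hardy) :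
    inner ℂ g (toeplitz b f) = inner ℂ (g : L2) (mulL2 b f) := inner_szego g _

lemma inner_hankel (u : C(Torus, ℂ)) (f g : Hardy) :
    inner ℂ g (hankel u f) = inner ℂ (g : L2) (mulL2 u (conjL2 f)) := inner_szego g _

lemma inner_toHardy (b : C(Torus, ℂ)) (g : Hardy) :
    inner ℂ g (toHardy b) = inner ℂ (g : L2) (toL2 b) := inner_szego g _

lemma coe_shift (f : Hardy) : (shift f : L2) = mulL2 (fourier 1) f :=
  coe_szego_of_mem (mulL2_mem_hardy (fourier_mem_hardy zero_le_one) f.2)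

lemma star_fourier_mul_self (n : ℤ) : (star (fourier n) * fourier n : C(Torus, ℂ)) = 1 := by
  rw [star_fourier, fourier_mul_fourier]
  ext x
  simp

lemma mulL2_one (f : L2) : mulL2 1 f = f := by
  apply Lp.ext
  filter_upwards [coeFn_mulL2 1 f] with x h
  rw [h]; simp

lemma inner_shift_shift (f g : Hardy) : inner ℂ (shift f) (shift g) = inner ℂ f g := by
  rw [Submodule.coe_inner, coe_shift, coe_shift, inner_mulL2_left, ← mulL2_mul,
    star_fourier_mul_self, mulL2_one]
  rfl

lemma norm_shift (f : Hardy) : ‖shift f‖ = ‖f‖ := by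
  rw [← sq_eq_sq₀ (norm_nonneg _) (norm_nonneg _), @norm_sq_eq_re_inner ℂ, @norm_sq_eq_re_inner ℂ,
    inner_shift_shift]

lemma inner_bshift (f g : Hardy) : inner ℂ g (bshift f) = inner ℂ (shift g) f :=
  ContinuousLinearMap.adjoint_inner_right _ _ _

lemma bshift_shift (f : Hardy) : bshift (shift f) = f :=
  Hardy.ext_inner fun k => by rw [inner_bshift, inner_shift_shift]

lemma shift_mode (n : ℕ) : shift (mode n) = mode (n + 1) := by
  apply Subtype.ext
  rw [coe_shift]
  change mulL2 _ (toL2 _) = toL2 _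
  rw [mulL2_toL2, fourier_mul_fourier, add_comm]
  rfl

lemma inner_mode_mode (m n : ℕ) : inner ℂ (mode m) (mode n) = if m = n then (1 : ℂ) else 0 := by
  refine (inner_fourier_fourier m n).trans ?_
  simp

lemma inner_mode_zero_shift (f : Hardy) : inner ℂ (mode 0) (shift f) = 0 := by
  rw [Submodule.coe_inner, coe_shift, ← inner_conj_symm, inner_mulL2_left, star_fourier]
  change conj (inner ℂ _ (mulL2 _ (toL2 _))) = 0
  rw [mulL2_toL2, fourier_mul_fourier, inner_conj_symm]
  exact (mem_hardy_iff _).1 f.2 _ (by norm_num)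

lemma shift_bshift (f : Hardy) : shift (bshift f) = f - inner ℂ (mode 0) f • mode 0 := by
  apply Hardy.eq_of_modes
  rintro (_ | n)
  · rw [inner_mode_zero_shift, inner_sub_right, Hardy.inner_smul_right, inner_mode_mode]
    simp
  · rw [← shift_mode, inner_shift_shift, inner_bshift, inner_sub_right, Hardy.inner_smul_right,
      shift_mode, inner_mode_mode]
    simp

lemma shift_bshift_of_inner_eq_zero {f : Hardy} (h : inner ℂ (mode 0) f = 0) :
    shift (bshift f) = f := by
  rw [shift_bshift, h, zero_smul, sub_zero]

/-- Both sides are the integral of `u f̄ ḡ`; this is self-adjointness for an antilinear operator. -/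
lemma inner_hankel_symm (u : C(Torus, ℂ)) (f g : Hardy) :
    inner ℂ g (hankel u f) = inner ℂ f (hankel u g) := by
  rw [inner_hankel, inner_hankel, inner_mulL2_conjL2]

/-- Both sides are `Π(z̄ u f̄)`. -/
lemma bshift_hankel (u : C(Torus, ℂ)) (f : Hardy) :
    bshift (hankel u f) = hankel u (shift f) := by
  apply Hardy.ext_inner
  intro k
  rw [inner_bshift, inner_hankel, inner_hankel, coe_shift, coe_shift, conjL2_mulL2,
    ← mulL2_mul, mul_comm u, mulL2_mul, inner_mulL2_left]

lemma shiftedHankel_eq_bshift (u : C(Torus, ℂ)) (f : Hardy) :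
    shiftedHankel u f = bshift (hankel u f) := rfl

lemma shiftedHankel_eq_hankel (u : C(Torus, ℂ)) (f : Hardy) :
    shiftedHankel u f = hankel u (shift f) := bshift_hankel u f

lemma shiftedHankel_shift (u : C(Torus, ℂ)) (f : Hardy) :
    shiftedHankel u (shift f) = bshift (shiftedHankel u f) := by
  rw [shiftedHankel_eq_bshift, ← shiftedHankel_eq_hankel]

lemma inner_shiftedHankel_symm (u : C(Torus, ℂ)) (f g : Hardy) :
    inner ℂ g (shiftedHankel u f) = inner ℂ f (shiftedHankel u g) := by
  rw [shiftedHankel_eq_bshift, inner_bshift, inner_hankel_symm, shiftedHankel_eq_hankel]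

lemma hankel_mode_zero (u : C(Torus, ℂ)) : hankel u (mode 0) = toHardy u := by
  apply Hardy.ext_inner
  intro k
  rw [inner_hankel, inner_toHardy]
  change inner ℂ _ (mulL2 u (conjL2 (toL2 (fourier 0)))) = _
  rw [conjL2_toL2, mulL2_toL2, star_fourier, neg_zero]
  congr 2
  ext x
  simp

lemma inner_mode_zero_hankel (u : C(Torus, ℂ)) (f : Hardy) :
    inner ℂ (mode 0) (hankel u f) = inner ℂ f (toHardy u) := by
  rw [inner_hankel_symm, hankel_mode_zero]

/-- Here `K_u² = H_u S S* H_u`, where `S S*` removes the mean value and `H_u 1 = u`. This rank-one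
relation links the spectra of `H_u` and `K_u`. -/
lemma shiftedHankel_shiftedHankel (u : C(Torus, ℂ)) (f : Hardy) :
    shiftedHankel u (shiftedHankel u f)
      = hankel u (hankel u f) - inner ℂ (toHardy u) f • toHardy u := by
  rw [shiftedHankel_eq_hankel, shiftedHankel_eq_bshift, shift_bshift, inner_mode_zero_hankel,
    map_sub, map_smulₛₗ, hankel_mode_zero, inner_conj_symm]

lemma inner_toeplitz_symm {b : C(Torus, ℂ)} (hb : star b = b) (f g : Hardy) :
    inner ℂ (toeplitz b f) g = inner ℂ f (toeplitz b g) := by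
  rw [← inner_conj_symm, inner_toeplitz, inner_conj_symm, inner_mulL2_left, hb, inner_toeplitz]

lemma bshift_toeplitz_shift (b : C(Torus, ℂ)) (f : Hardy) :
    bshift (toeplitz b (shift f)) = toeplitz b f := by
  apply Hardy.ext_inner
  intro k
  rw [inner_bshift, inner_toeplitz, inner_toeplitz, coe_shift, coe_shift, inner_mulL2_left,
    ← mulL2_mul, ← mulL2_mul, mul_right_comm, star_fourier_mul_self, one_mul]

lemma coe_toHardy {u : C(Torus, ℂ)} (hu : toL2 u ∈ hardySubmodule) : (toHardy u : L2) = toL2 u :=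
  coe_szego_of_mem hu

lemma toeplitz_mode_zero {u : C(Torus, ℂ)} (hu : toL2 u ∈ hardySubmodule) :
    toeplitz (star u * u) (mode 0) = hankel u (toHardy u) := by
  apply Hardy.ext_inner
  intro k
  rw [inner_toeplitz, inner_hankel, coe_toHardy hu, conjL2_toL2]
  change inner ℂ _ (mulL2 _ (toL2 (fourier 0))) = _
  rw [mulL2_toL2, mulL2_toL2]
  congr 2
  ext x
  simp [mul_comm]

lemma toeplitz_toHardy {u : C(Torus, ℂ)} (hu : toL2 u ∈ hardySubmodule) (b : C(Torus, ℂ)) :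
    toeplitz b (toHardy u) = toHardy (b * u) := by
  apply Hardy.ext_inner
  intro k
  rw [inner_toeplitz, inner_toHardy, coe_toHardy hu, mulL2_toL2]

/-- The Hankel operator of `Π(|u|² u)`. -/
lemma hankel_cubic {u : C(Torus, ℂ)} (hu : toL2 u ∈ hardySubmodule) (h : Hardy) :
    hankel (star u * u * u) h = toeplitz (star u * u) (hankel u h)
      + hankel u (toeplitz (star u * u) h) - hankel u (hankel u (hankel u h)) := by
  -- `r` is the part of `u h̄` killed by `Π`. Its conjugate is in the Hardy space, hence so is `u
  -- r̄`, and in `key` no projector is left: `T_{|u|²} h - H_u² h = u r̄`.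
  set r : L2 := mulL2 u (conjL2 h) - hankel u h with hr
  have hr0 : ∀ g ∈ hardySubmodule, inner ℂ g r = 0 := by
    intro g hg
    have := inner_hankel u h ⟨g, hg⟩
    rw [hr, inner_sub_right, ← this]
    exact sub_self _
  have hmem : mulL2 u (conjL2 r) ∈ hardySubmodule := mulL2_mem_hardy hu (conjL2_mem_hardy hr0)
  have key : toeplitz (star u * u) h - hankel u (hankel u h) = ⟨mulL2 u (conjL2 r), hmem⟩ := by
    apply Hardy.ext_inner
    intro k
    rw [inner_sub_right, inner_toeplitz, inner_hankel, ← inner_sub_right, Submodule.coe_inner]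
    congr 1
    change _ = mulL2 u (conjL2 (mulL2 u (conjL2 h) - hankel u h))
    rw [map_sub, map_sub, conjL2_mulL2, conjL2_conjL2, mul_comm (star u), mulL2_mul]
  rw [add_sub_assoc, ← map_sub, key]
  apply Hardy.ext_inner
  intro k
  rw [inner_add_right, inner_hankel, inner_toeplitz, inner_hankel, ← inner_add_right]
  congr 1
  change _ = _ + mulL2 u (conjL2 (mulL2 u (conjL2 r)))
  rw [conjL2_mulL2, conjL2_conjL2, ← mulL2_mul, mul_comm u, ← map_add, mulL2_mul, hr]
  simp

/-- The Lax identity for the shifted Hankel operator of `Π(|u|² u)`. -/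
lemma shiftedHankel_cubic {u : C(Torus, ℂ)} (hu : toL2 u ∈ hardySubmodule) (h : Hardy) :
    shiftedHankel (star u * u * u) h = toeplitz (star u * u) (shiftedHankel u h)
      + shiftedHankel u (toeplitz (star u * u) h)
      - shiftedHankel u (shiftedHankel u (shiftedHankel u h)) := by
  -- The backward shift commutes with `T_{|u|²}` up to a rank-one term, by `T_{|u|²} 1 = H_u u`.
  -- That term cancels against the one in `h4`, which comes from `H_u² - K_u²`.
  have h1 : bshift (toeplitz (star u * u) (hankel u h))
      = toeplitz (star u * u) (shiftedHankel u h)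
        + inner ℂ (mode 0) (hankel u h) • shiftedHankel u (toHardy u) := by
    have h2 : hankel u h = shift (shiftedHankel u h) + inner ℂ (mode 0) (hankel u h) • mode 0 := by
      rw [shiftedHankel_eq_bshift, shift_bshift]; abel
    conv_lhs => rw [h2]
    rw [map_add, map_add, bshift_toeplitz_shift, map_smul, map_smul, toeplitz_mode_zero hu]
    rfl
  rw [shiftedHankel_shiftedHankel, shiftedHankel_eq_bshift, hankel_cubic hu, map_sub, map_add, h1,
    inner_mode_zero_hankel]
  simp only [← shiftedHankel_eq_bshift]
  have h3 : inner ℂ (toHardy u) (shiftedHankel u h) • toHardy u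
      = hankel u (hankel u (shiftedHankel u h)) - shiftedHankel u (shiftedHankel u (shiftedHankel u h)) := by
    rw [shiftedHankel_shiftedHankel]; abel
  rw [h3]
  have h4 : shiftedHankel u (hankel u (hankel u h))
      = shiftedHankel u (shiftedHankel u (shiftedHankel u h))
        + inner ℂ h (toHardy u) • shiftedHankel u (toHardy u) := by
    rw [shiftedHankel_shiftedHankel u h, map_sub, map_smulₛₗ, inner_conj_symm]; abel
  rw [h4]
  abel

/-- On the functions orthogonal to `1` and to `u`, the square of `K_u` commutes with the backward
shift. -/
lemma bshift_shiftedHankel_sq {u : C(Torus, ℂ)} {f : Hardy} (h1 : inner ℂ (mode 0) f = 0)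
    (hu : inner ℂ (toHardy u) f = 0) :
    bshift (shiftedHankel u (shiftedHankel u f))
      = shiftedHankel u (shiftedHankel u (bshift f)) := by
  rw [shiftedHankel_shiftedHankel u f, hu, zero_smul, sub_zero, ← shiftedHankel_eq_bshift,
    shiftedHankel_eq_hankel u (bshift f), shift_bshift_of_inner_eq_zero h1]

lemma bshift_toeplitz {b : C(Torus, ℂ)} {f : Hardy} (h1 : inner ℂ (mode 0) f = 0) :
    bshift (toeplitz b f) = toeplitz b (bshift f) := by
  conv_lhs => rw [← shift_bshift_of_inner_eq_zero h1]
  rw [bshift_toeplitz_shift]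

lemma norm_hankel_le (u : C(Torus, ℂ)) (f : Hardy) : ‖hankel u f‖ ≤ ‖u‖ * ‖f‖ := by
  refine (norm_szego_le _).trans ((norm_mulL2_le _ _).trans_eq ?_)
  exact congrArg _ (norm_conjL2 f)

lemma norm_shiftedHankel_le (u : C(Torus, ℂ)) (f : Hardy) :
    ‖shiftedHankel u f‖ ≤ ‖u‖ * ‖f‖ := by
  rw [shiftedHankel_eq_hankel]
  exact (norm_hankel_le _ _).trans_eq (by rw [norm_shift])

lemma norm_toeplitz_le (b : C(Torus, ℂ)) (f : Hardy) : ‖toeplitz b f‖ ≤ ‖b‖ * ‖f‖ :=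
  (norm_szego_le _).trans (norm_mulL2_le _ _)

lemma hankel_add (a b : C(Torus, ℂ)) (f : Hardy) :
    hankel (a + b) f = hankel a f + hankel b f := by
  change szego (mulL2 _ _) = szego (mulL2 _ _) + szego (mulL2 _ _)
  rw [mulL2_add, map_add]

lemma hankel_smul (c : ℂ) (b : C(Torus, ℂ)) (f : Hardy) :
    hankel (c • b) f = c • hankel b f := by
  change szego (mulL2 _ _) = c • szego (mulL2 _ _)
  rw [mulL2_smul, map_smul]

lemma shiftedHankel_add (a b : C(Torus, ℂ)) (f : Hardy) :
    shiftedHankel (a + b) f = shiftedHankel a f + shiftedHankel b f := by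
  simp only [shiftedHankel_eq_hankel, hankel_add]

lemma shiftedHankel_smul (c : ℂ) (b : C(Torus, ℂ)) (f : Hardy) :
    shiftedHankel (c • b) f = c • shiftedHankel b f := by
  simp only [shiftedHankel_eq_hankel, hankel_smul]

lemma toeplitz_add (a b : C(Torus, ℂ)) (f : Hardy) :
    toeplitz (a + b) f = toeplitz a f + toeplitz b f := by
  change szego (mulL2 _ _) = szego (mulL2 _ _) + szego (mulL2 _ _)
  rw [mulL2_add, map_add]

lemma toeplitz_smul (c : ℂ) (b : C(Torus, ℂ)) (f : Hardy) :
    toeplitz (c • b) f = c • toeplitz b f := by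
  change szego (mulL2 _ _) = c • szego (mulL2 _ _)
  rw [mulL2_smul, map_smul]

lemma inner_mode_bshift_iterate (n : ℕ) (f : Hardy) :
    inner ℂ (mode 0) (bshift^[n] f) = inner ℂ (mode n) f := by
  induction n generalizing f with
  | zero => rfl
  | succ n ih => rw [Function.iterate_succ_apply, ih, inner_bshift, shift_mode]

/-- A space stable under the backward shift and orthogonal to the constants is trivial. -/
lemma eq_zero_of_bshift_invariant {E : Set Hardy} (h1 : ∀ f ∈ E, inner ℂ (mode 0) f = 0)
    (hE : ∀ f ∈ E, bshift f ∈ E) {f : Hardy} (hf : f ∈ E) : f = 0 := by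
  apply Hardy.eq_of_modes
  intro n
  rw [← inner_mode_bshift_iterate, inner_zero_right]
  refine h1 _ ?_
  induction n with
  | zero => exact hf
  | succ n ih => rw [Function.iterate_succ_apply']; exact hE _ ih

/-! ### Eigenspaces -/

lemma mem_eigenK {u : C(Torus, ℂ)} {σ : ℝ} {f : Hardy} :
    f ∈ eigenK u σ ↔ shiftedHankel u (shiftedHankel u f) = ((σ : ℂ) ^ 2) • f := by
  unfold eigenK
  rw [LinearMap.mem_ker]
  exact sub_eq_zero

lemma mem_eigenH {u : C(Torus, ℂ)} {σ : ℝ} {f : Hardy} :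
    f ∈ eigenH u σ ↔ hankel u (hankel u f) = ((σ : ℂ) ^ 2) • f := by
  unfold eigenH
  rw [LinearMap.mem_ker]
  exact sub_eq_zero

lemma shiftedHankel_mem_eigenK {u : C(Torus, ℂ)} {σ : ℝ} {f : Hardy} (hf : f ∈ eigenK u σ) :
    shiftedHankel u f ∈ eigenK u σ := by
  rw [mem_eigenK] at hf ⊢
  rw [hf, map_smulₛₗ]
  simp

lemma hankel_mem_eigenH {u : C(Torus, ℂ)} {σ : ℝ} {f : Hardy} (hf : f ∈ eigenH u σ) :
    hankel u f ∈ eigenH u σ := by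
  rw [mem_eigenH] at hf ⊢
  rw [hf, map_smulₛₗ]
  simp

lemma norm_shiftedHankel_of_mem {u : C(Torus, ℂ)} {σ : ℝ} (hσ : 0 ≤ σ) {f : Hardy}
    (hf : f ∈ eigenK u σ) : ‖shiftedHankel u f‖ = σ * ‖f‖ := by
  rw [← sq_eq_sq₀ (norm_nonneg _) (by positivity), mul_pow, @norm_sq_eq_re_inner ℂ,
    inner_shiftedHankel_symm, mem_eigenK.1 hf, Hardy.inner_smul_right, @norm_sq_eq_re_inner ℂ _ _ _ _ f,
    ← ofReal_pow]
  exact re_ofReal_mul _ _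

lemma mem_eigenH_iff_of_inner_eq_zero {u : C(Torus, ℂ)} {σ : ℝ} {f : Hardy}
    (h : inner ℂ (toHardy u) f = 0) : f ∈ eigenH u σ ↔ f ∈ eigenK u σ := by
  rw [mem_eigenH, mem_eigenK, shiftedHankel_shiftedHankel, h, zero_smul, sub_zero]

/-! ### Polynomials of the shift -/

lemma aeval_mul_apply (p q : Polynomial ℂ) (f : Hardy) :
    Polynomial.aeval shift (p * q) f = Polynomial.aeval shift p (Polynomial.aeval shift q f) := by
  rw [map_mul]; rfl

lemma aeval_X_sub_C_apply (a : ℂ) (f : Hardy) :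
    Polynomial.aeval shift (Polynomial.X - Polynomial.C a) f = shift f - a • f := by
  rw [map_sub, Polynomial.aeval_X, Polynomial.aeval_C, Algebra.algebraMap_eq_smul_one]; rfl

lemma aeval_C_apply (a : ℂ) (f : Hardy) :
    Polynomial.aeval shift (Polynomial.C a) f = a • f := by
  rw [Polynomial.aeval_C, Algebra.algebraMap_eq_smul_one]; rfl

lemma aeval_apply_eq_sum {p : Polynomial ℂ} {n : ℕ} (hp : p.natDegree < n) (f : Hardy) :
    Polynomial.aeval shift p f = ∑ i ∈ Finset.range n, p.coeff i • (shift ^ i) f := by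
  rw [Polynomial.aeval_eq_sum_range' hp, sum_apply]; rfl

lemma shift_pow_succ_apply (n : ℕ) (f : Hardy) : (shift ^ (n + 1)) f = shift ((shift ^ n) f) := by
  rw [pow_succ']; rfl

lemma norm_shift_pow (n : ℕ) (f : Hardy) : ‖(shift ^ n) f‖ = ‖f‖ := by
  induction n with
  | zero => rfl
  | succ n ih => rw [shift_pow_succ_apply, norm_shift, ih]

/-- The shift has no eigenvector: `a f̂(0) = 0` and `a f̂(n+1) = f̂(n)` kill all coefficients. -/
lemma eq_zero_of_shift_eq_smul {a : ℂ} {f : Hardy} (h : shift f = a • f) : f = 0 := by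
  have h0 : a * inner ℂ (mode 0) f = 0 := by
    rw [← Hardy.inner_smul_right, ← h, inner_mode_zero_shift]
  have h1 (n : ℕ) : a * inner ℂ (mode (n + 1)) f = inner ℂ (mode n) f := by
    rw [← Hardy.inner_smul_right, ← h, ← shift_mode, inner_shift_shift]
  apply Hardy.eq_of_modes
  intro n
  rw [inner_zero_right]
  by_cases ha : a = 0
  · rw [← h1, ha, zero_mul]
  · induction n with
    | zero => simpa [ha] using h0
    | succ n ih => simpa [ha, ih] using h1 n

/-- Split off linear factors. The result makes polynomials legitimate coordinates on the cyclic
space of `f`, so that degrees can be compared. -/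
lemma aeval_shift_ne_zero {p : Polynomial ℂ} (hp : p ≠ 0) {f : Hardy} (hf : f ≠ 0) :
    Polynomial.aeval shift p f ≠ 0 := by
  induction hn : p.natDegree generalizing p with
  | zero =>
    rw [Polynomial.eq_C_of_natDegree_eq_zero hn] at hp ⊢
    rw [aeval_C_apply]
    exact smul_ne_zero (by simpa using hp) hf
  | succ n ih =>
    obtain ⟨a, ha⟩ := IsAlgClosed.exists_root p (by
      rw [Polynomial.degree_eq_natDegree hp, hn]; exact_mod_cast Nat.succ_ne_zero n)
    obtain ⟨q, rfl⟩ := Polynomial.dvd_iff_isRoot.2 ha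
    have hq : q ≠ 0 := right_ne_zero_of_mul hp
    rw [Polynomial.natDegree_mul (Polynomial.X_sub_C_ne_zero a) hq, Polynomial.natDegree_X_sub_C]
      at hn
    rw [aeval_mul_apply, aeval_X_sub_C_apply, sub_ne_zero]
    exact fun h => ih hq (by omega) (eq_zero_of_shift_eq_smul h)

lemma aeval_shift_injective {f : Hardy} (hf : f ≠ 0) {p q : Polynomial ℂ}
    (h : Polynomial.aeval shift p f = Polynomial.aeval shift q f) : p = q := by
  by_contra hpq
  refine aeval_shift_ne_zero (sub_ne_zero.2 hpq) hf ?_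
  rw [map_sub]
  exact sub_eq_zero.2 h

lemma coeFn_aeval (p : Polynomial ℂ) (f : Hardy) :
    ((Polynomial.aeval shift p f : Hardy) : L2)
      =ᵐ[circleMeasure] fun x => p.eval (fourier 1 x) * (f : L2) x := by
  induction p using Polynomial.induction_on' with
  | add p q hp hq =>
    have h : ((Polynomial.aeval shift (p + q) f : Hardy) : L2)
        = (Polynomial.aeval shift p f : Hardy) + (Polynomial.aeval shift q f : Hardy) := by
      rw [map_add]; rfl
    rw [h]
    filter_upwards [hp, hq, Lp.coeFn_add ((Polynomial.aeval shift p f : Hardy) : L2)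
      (Polynomial.aeval shift q f : Hardy)] with x h1 h2 h3
    rw [h3, Pi.add_apply, h1, h2, Polynomial.eval_add, add_mul]
  | monomial n a =>
    induction n with
    | zero =>
      rw [Polynomial.monomial_zero_left, aeval_C_apply]
      filter_upwards [Lp.coeFn_smul a (f : L2)] with x h
      rw [Polynomial.eval_C]
      exact h
    | succ n ih =>
      have h : Polynomial.monomial (n + 1) a = Polynomial.X * Polynomial.monomial n a := by
        rw [Polynomial.X_mul_monomial]
      rw [h, aeval_mul_apply, Polynomial.aeval_X, coe_shift]
      filter_upwards [ih, coeFn_mulL2 (fourier 1)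
        (Polynomial.aeval shift (Polynomial.monomial n a) f : Hardy)] with x h1 h2
      rw [h2, h1, Polynomial.eval_mul, Polynomial.eval_X, mul_assoc]

/-! ### Finite Blaschke products -/

namespace BlaschkeProduct

lemma D_eval (Ψ : BlaschkeProduct) {z : ℂ} (hz : z ≠ 0) :
    Ψ.D.eval z = z ^ Ψ.degree * conj (Ψ.P.eval (conj z)⁻¹) := by
  have hz' : z⁻¹ ≠ 0 := inv_ne_zero hz
  let _ := invertibleOfNonzero hz'
  have h := Polynomial.eval₂_reverse_mul_pow (RingHom.id ℂ) z⁻¹ (Ψ.P.map (starRingEnd ℂ))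
  rw [invOf_eq_inv, inv_inv, Polynomial.natDegree_map] at h
  have h2 : (Ψ.P.map (starRingEnd ℂ)).eval z⁻¹ = conj (Ψ.P.eval (conj z)⁻¹) := by
    have h3 := Polynomial.eval_map_apply (f := starRingEnd ℂ) (p := Ψ.P) ((conj z)⁻¹)
    rw [← h3, map_inv₀, conj_conj]
  rw [← h2]
  change _ = z ^ Ψ.P.natDegree * Polynomial.eval₂ (RingHom.id ℂ) z⁻¹ _
  rw [← h, mul_comm, mul_assoc, ← mul_pow, inv_mul_cancel₀ hz, one_pow, mul_one]
  rfl

lemma D_coeff_zero (Ψ : BlaschkeProduct) : Ψ.D.coeff 0 = 1 := by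
  rw [D, Polynomial.coeff_zero_reverse]
  exact Ψ.monic.map _

lemma D_ne_zero (Ψ : BlaschkeProduct) : Ψ.D ≠ 0 := by
  intro h
  have := Ψ.D_coeff_zero
  simp [h] at this

lemma one_lt_norm_of_D_root (Ψ : BlaschkeProduct) {z : ℂ} (hz : Ψ.D.eval z = 0) : 1 < ‖z‖ := by
  have h0 : z ≠ 0 := by
    rintro rfl
    rw [← Polynomial.coeff_zero_eq_eval_zero, D_coeff_zero] at hz
    exact one_ne_zero hz
  rw [D_eval _ h0, mul_eq_zero, or_iff_right (pow_ne_zero _ h0), map_eq_zero] at hz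
  have := Ψ.norm_lt_one _ ((Polynomial.mem_roots Ψ.monic.ne_zero).2 hz)
  rw [norm_inv, Complex.norm_conj] at this
  exact (inv_lt_one₀ (norm_pos_iff.2 h0)).1 this

lemma D_eval_fourier_ne_zero (Ψ : BlaschkeProduct) (x : Torus) : Ψ.D.eval (fourier 1 x) ≠ 0 := by
  intro h
  have h1 := Ψ.one_lt_norm_of_D_root h
  have h2 : ‖(fourier 1 x : ℂ)‖ = 1 := Circle.norm_coe _
  rw [h2] at h1
  exact lt_irrefl _ h1

lemma P_eq_of_roots_eq {Ψ Ψ' : BlaschkeProduct} (h : Ψ.P.roots = Ψ'.P.roots) : Ψ.P = Ψ'.P := by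
  rw [(IsAlgClosed.splits Ψ.P).eq_prod_roots_of_monic Ψ.monic, h,
    ← (IsAlgClosed.splits Ψ'.P).eq_prod_roots_of_monic Ψ'.monic]

/-- The roots of a denominator lie outside the closed disc, so the open disc sees only the
numerator. Cross-multiplied identities therefore determine the zeros. -/
lemma roots_filter (Ψ Ψ' : BlaschkeProduct) :
    (Ψ.P * Ψ'.D).roots.filter (fun a => ‖a‖ < 1) = Ψ.P.roots := by
  rw [Polynomial.roots_mul (mul_ne_zero Ψ.monic.ne_zero Ψ'.D_ne_zero), Multiset.filter_add,
    Multiset.filter_eq_self.2 Ψ.norm_lt_one, Multiset.filter_eq_nil.2, add_zero]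
  intro a ha
  rw [not_lt]
  exact (Ψ'.one_lt_norm_of_D_root ((Polynomial.mem_roots Ψ'.D_ne_zero).1 ha)).le

lemma ext_of_mul_eq {Ψ Ψ' : BlaschkeProduct}
    (h : Polynomial.C ((-Ψ.angle).toCircle : ℂ) * (Ψ.P * Ψ'.D)
      = Polynomial.C ((-Ψ'.angle).toCircle : ℂ) * (Ψ'.P * Ψ.D)) : Ψ = Ψ' := by
  have hP : Ψ.P = Ψ'.P := by
    apply P_eq_of_roots_eq
    rw [← roots_filter Ψ Ψ', ← roots_filter Ψ' Ψ,
      ← Polynomial.roots_C_mul (Ψ.P * Ψ'.D) (Circle.coe_ne_zero (-Ψ.angle).toCircle), h,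
      Polynomial.roots_C_mul _ (Circle.coe_ne_zero (-Ψ'.angle).toCircle)]
  have hD : Ψ.D = Ψ'.D := by rw [D, D, hP]
  rw [hP, hD] at h
  have hc := mul_right_cancel₀ (mul_ne_zero Ψ'.monic.ne_zero Ψ'.D_ne_zero) h
  have hc' : (-Ψ.angle).toCircle = (-Ψ'.angle).toCircle :=
    Circle.ext (Polynomial.C_injective hc)
  have ha : Ψ.angle = Ψ'.angle := by
    rw [← neg_inj, ← Real.Angle.arg_toCircle (-Ψ.angle), hc', Real.Angle.arg_toCircle]
  cases Ψ; cases Ψ'; simp_all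

/-- The Blaschke product whose denominator is proportional to a given polynomial without roots in
the closed unit disc. -/
lemma exists_of_roots {n : ℕ} {Q : Polynomial ℂ} (hn : Q.natDegree ≤ n)
    (hQ : ∀ a, Q.eval a = 0 → 1 < ‖a‖) (θ : Real.Angle) :
    ∃ Ψ : BlaschkeProduct, Ψ.angle = θ ∧ Ψ.degree = n ∧
      Ψ.P = Polynomial.C (conj (Q.coeff 0))⁻¹ * (Q.map (starRingEnd ℂ)).reflect n ∧
      Ψ.D = Polynomial.C (Q.coeff 0)⁻¹ * Q := by
  have h0 : Q.coeff 0 ≠ 0 := by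
    intro h
    rw [Polynomial.coeff_zero_eq_eval_zero] at h
    have := hQ 0 h
    norm_num at this
  have h0' : conj (Q.coeff 0) ≠ 0 := (map_ne_zero _).2 h0
  -- The reflection is in degree `n`, not in the degree of `Q`: when `deg Q < n`, the polynomial `P`
  -- acquires zeros at the origin, and its degree is still `n`.
  set P : Polynomial ℂ := Polynomial.C (conj (Q.coeff 0))⁻¹ * (Q.map (starRingEnd ℂ)).reflect n
    with hP
  have hle : P.natDegree ≤ n := by
    rw [hP, Polynomial.natDegree_C_mul (inv_ne_zero h0')]
    refine Polynomial.natDegree_reflect_le.trans ?_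
    rw [Polynomial.natDegree_map]
    exact (max_eq_left hn).le
  have hcoeff : P.coeff n = 1 := by
    rw [hP, Polynomial.coeff_C_mul, Polynomial.coeff_reflect, Polynomial.revAt_le le_rfl,
      Nat.sub_self, Polynomial.coeff_map, inv_mul_cancel₀ h0']
  have hdeg : P.natDegree = n := le_antisymm hle (Polynomial.le_natDegree_of_ne_zero (by simp [hcoeff]))
  have hmonic : P.Monic := by rw [Polynomial.Monic, Polynomial.leadingCoeff, hdeg, hcoeff]
  have hcc : (starRingEnd ℂ).comp (starRingEnd ℂ) = RingHom.id ℂ := by ext; simp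
  have hD : (P.map (starRingEnd ℂ)).reverse = Polynomial.C (Q.coeff 0)⁻¹ * Q := by
    rw [Polynomial.reverse, Polynomial.natDegree_map, hdeg, hP, Polynomial.map_mul,
      Polynomial.map_C, ← Polynomial.reflect_map, Polynomial.map_map, Polynomial.reflect_C_mul,
      Polynomial.reflect_reflect, hcc, Polynomial.map_id, map_inv₀,
      conj_conj]
  refine ⟨⟨θ, P, hmonic, ?_⟩, rfl, hdeg, rfl, hD⟩
  intro a ha
  rw [Polynomial.mem_roots hmonic.ne_zero] at ha
  by_cases ha0 : a = 0
  · simp [ha0]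
  let _ := invertibleOfNonzero ha0
  have h1 := (Polynomial.eval₂_reverse_eq_zero_iff (RingHom.id ℂ) a P).2 ha
  rw [invOf_eq_inv] at h1
  have h2 : ((P.map (starRingEnd ℂ)).reverse).eval (conj a⁻¹) = 0 := by
    have : (P.map (starRingEnd ℂ)).reverse = P.reverse.map (starRingEnd ℂ) := by
      rw [Polynomial.reverse, Polynomial.reverse, Polynomial.natDegree_map, Polynomial.reflect_map]
    rw [this, Polynomial.eval_map_apply]
    exact (congrArg conj h1).trans (map_zero _)
  rw [hD, Polynomial.eval_mul, Polynomial.eval_C, mul_eq_zero, or_iff_right (inv_ne_zero h0)] at h2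
  have h3 := hQ _ h2
  rw [Complex.norm_conj, norm_inv] at h3
  exact (one_lt_inv₀ (norm_pos_iff.2 ha0)).1 h3

end BlaschkeProduct

/-- A Blaschke factor is determined by the equation, since `u'_σ ≠ 0`. -/
lemma IsBlaschkeFactor.unique {u : C(Torus, ℂ)} {σ : ℝ} (hσ : 0 < σ) (hv : projK u σ ≠ 0)
    {Ψ Ψ' : BlaschkeProduct} (h : IsBlaschkeFactor u σ Ψ) (h' : IsBlaschkeFactor u σ Ψ') :
    Ψ = Ψ' := by
  apply BlaschkeProduct.ext_of_mul_eq
  apply aeval_shift_injective hv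
  apply Subtype.ext
  apply Lp.ext
  filter_upwards [h, h', coeFn_aeval (Polynomial.C ((-Ψ.angle).toCircle : ℂ) * (Ψ.P * Ψ'.D))
    (projK u σ), coeFn_aeval (Polynomial.C ((-Ψ'.angle).toCircle : ℂ) * (Ψ'.P * Ψ.D))
    (projK u σ)] with x h1 h2 h3 h4
  rw [h3, h4]
  rw [h1] at h2
  have hD := Ψ.D_eval_fourier_ne_zero x
  have hD' := Ψ'.D_eval_fourier_ne_zero x
  have hs : (σ : ℂ) ≠ 0 := ofReal_ne_zero.2 hσ.ne'
  simp only [BlaschkeProduct.eval] at h2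
  simp only [Polynomial.eval_mul, Polynomial.eval_C]
  have h5 := mul_left_cancel₀ hs ((mul_assoc _ _ _).symm.trans (h2.trans (mul_assoc _ _ _)))
  field_simp at h5
  linear_combination h5

/-! ### Eigenspaces are finite-dimensional -/

lemma inner_hankel_mode (u : C(Torus, ℂ)) (n : ℕ) (g : Hardy) :
    inner ℂ g (hankel u (mode n)) = inner ℂ (g : L2) (toL2 (u * fourier (-n))) := by
  rw [inner_hankel]
  change inner ℂ _ (mulL2 u (conjL2 (toL2 (fourier n)))) = _
  rw [conjL2_toL2, mulL2_toL2, star_fourier]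

/-- `K` with symbol `z^k` sends `z^n` to `z^(k-1-n)`, or to `0` if this exponent is negative, so it
involves only the modes below `k`. -/
lemma shiftedHankel_fourier_eq_zero (k : ℤ) {f : Hardy}
    (hf : ∀ n : ℕ, (n : ℤ) < k → inner ℂ (mode n) f = 0) : shiftedHankel (fourier k) f = 0 := by
  apply Hardy.eq_of_modes
  intro n
  rw [inner_zero_right, inner_shiftedHankel_symm, shiftedHankel_eq_hankel, shift_mode,
    inner_hankel_mode, fourier_mul_fourier, ← inner_conj_symm]
  rcases lt_or_ge (k + -((n + 1 : ℕ) : ℤ)) 0 with h | h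
  · rw [(mem_hardy_iff _).1 f.2 _ h, map_zero]
  · obtain ⟨j, hj⟩ := Int.eq_ofNat_of_zero_le h
    have h1 : inner ℂ (toL2 (fourier (j : ℤ))) (f : L2) = 0 := hf j (by omega)
    rw [hj, h1, map_zero]

lemma exists_shiftedHankel_eq_zero {p : C(Torus, ℂ)}
    (hp : p ∈ Submodule.span ℂ (Set.range (fourier (T := 2 * π)))) :
    ∃ N : ℕ, ∀ f : Hardy, (∀ n < N, inner ℂ (mode n) f = 0) → shiftedHankel p f = 0 := by
  induction hp using Submodule.span_induction with
  | mem x hx =>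
    obtain ⟨k, rfl⟩ := hx
    exact ⟨k.toNat, fun f hf => shiftedHankel_fourier_eq_zero k fun n hn => hf n (by omega)⟩
  | zero =>
    refine ⟨0, fun f _ => ?_⟩
    have := shiftedHankel_smul 0 0 f
    simpa using this
  | add x y _ _ hx hy =>
    obtain ⟨N, hN⟩ := hx
    obtain ⟨M, hM⟩ := hy
    refine ⟨max N M, fun f hf => ?_⟩
    rw [shiftedHankel_add, hN f fun n hn => hf n (lt_max_of_lt_left hn),
      hM f fun n hn => hf n (lt_max_of_lt_right hn), add_zero]
  | smul c x _ hx =>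
    obtain ⟨N, hN⟩ := hx
    refine ⟨N, fun f hf => ?_⟩
    rw [shiftedHankel_smul, hN f hf, smul_zero]

/-- Compactness by hand: take a trigonometric polynomial `p` with `‖u - p‖ < σ`. A vector of
`F_u(σ)` with vanishing first `N` modes satisfies `σ ‖f‖ = ‖K_(u-p) f‖ ≤ ‖u - p‖ ‖f‖`, so it is
zero. -/
lemma finiteDimensional_eigenK (u : C(Torus, ℂ)) {σ : ℝ} (hσ : 0 < σ) :
    FiniteDimensional ℂ (eigenK u σ) := by
  have hu : u ∈ closure (Submodule.span ℂ (Set.range (fourier (T := 2 * π))) : Set C(Torus, ℂ)) := by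
    rw [← Submodule.topologicalClosure_coe, span_fourier_closure_eq_top]
    trivial
  obtain ⟨p, hp, hup⟩ := Metric.mem_closure_iff.1 hu σ hσ
  obtain ⟨N, hN⟩ := exists_shiftedHankel_eq_zero hp
  let φ : eigenK u σ →ₗ[ℂ] (Fin N → ℂ) :=
    LinearMap.pi fun n => (innerSL ℂ (mode n)).toLinearMap ∘ₗ (eigenK u σ).subtype
  refine Module.Finite.of_injective φ ?_
  rw [← LinearMap.ker_eq_bot, LinearMap.ker_eq_bot']
  intro f hf
  have h0 : shiftedHankel p f = 0 := hN f fun n hn => congrFun hf ⟨n, hn⟩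
  have h1 : shiftedHankel u f = shiftedHankel (u - p) f := by
    have := shiftedHankel_add (u - p) p f
    rw [sub_add_cancel, h0, add_zero] at this
    exact this
  have h2 := norm_shiftedHankel_le (u - p) f
  rw [← h1, norm_shiftedHankel_of_mem hσ.le f.2, ← dist_eq_norm] at h2
  by_contra hne
  have h3 : 0 < ‖(f : Hardy)‖ := norm_pos_iff.2 fun h => hne (Subtype.ext h)
  exact absurd (le_of_mul_le_mul_right h2 h3) (not_le.2 hup)

/-! ### The projection of `u` onto an eigenspace -/

lemma projK_mem (u : C(Torus, ℂ)) (σ : ℝ) : projK u σ ∈ eigenK u σ :=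
  Submodule.starProjection_apply_mem _ _

lemma inner_projK {u : C(Torus, ℂ)} {σ : ℝ} {f : Hardy} (hf : f ∈ eigenK u σ) :
    inner ℂ (projK u σ) f = inner ℂ (toHardy u) f := by
  have h := Submodule.starProjection_inner_eq_zero (K := eigenK u σ) (toHardy u) f hf
  have h1 : inner ℂ (toHardy u) f - inner ℂ (projK u σ) f = 0 := by
    rw [← inner_sub_left]; exact h
  exact (sub_eq_zero.1 h1).symm

lemma projK_eq_zero_iff {u : C(Torus, ℂ)} {σ : ℝ} :
    projK u σ = 0 ↔ toHardy u ∈ (eigenK u σ)ᗮ := by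
  constructor
  · intro h
    rw [Submodule.mem_orthogonal']
    intro f hf
    exact (inner_projK hf).symm.trans (by rw [h, inner_zero_left])
  · intro h
    rw [Submodule.mem_orthogonal'] at h
    rw [← inner_self_eq_zero (𝕜 := ℂ)]
    exact (inner_projK (projK_mem u σ)).trans (h _ (projK_mem u σ))

lemma mem_SigmaK_iff {u : C(Torus, ℂ)} {σ : ℝ} (hσ : 0 < σ) : σ ∈ SigmaK u ↔ projK u σ ≠ 0 := by
  rw [Ne, projK_eq_zero_iff]
  exact and_iff_right hσ.le

/-- Compare `⟨g, H_u² h⟩` with `⟨H_u² g, h⟩` for `g = u'_σ`: both contain `σ² ⟨g, h⟩`, and the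
rank-one term leaves a multiple of `⟨u, h⟩` whose factor has modulus `‖u'_σ‖² ≠ 0`. -/
lemma inner_eigenH_eq_zero {u : C(Torus, ℂ)} {σ : ℝ} (hv : projK u σ ≠ 0) {h : Hardy}
    (hh : h ∈ eigenH u σ) : inner ℂ (toHardy u) h = 0 := by
  set g := projK u σ with hg
  have hgm : g ∈ eigenK u σ := projK_mem u σ
  have h1 : inner ℂ (toHardy u) g ≠ 0 := by
    rw [← inner_projK hgm]
    exact inner_self_ne_zero.2 hv
  have h2 : inner ℂ g (hankel u (hankel u h)) = conj (inner ℂ h (hankel u (hankel u g))) := by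
    rw [inner_hankel_symm, inner_hankel_symm u _ h, inner_conj_symm]
  have h3 : hankel u (hankel u g) = ((σ : ℂ) ^ 2) • g + inner ℂ (toHardy u) g • toHardy u := by
    rw [← mem_eigenK.1 hgm, shiftedHankel_shiftedHankel, sub_add_cancel]
  rw [mem_eigenH.1 hh, h3, inner_add_right, Hardy.inner_smul_right, Hardy.inner_smul_right,
    Hardy.inner_smul_right, map_add, map_mul, map_mul, inner_conj_symm _ h, inner_conj_symm _ h,
    map_pow, conj_ofReal] at h2
  have h4 : conj (inner ℂ (toHardy u) g) * inner ℂ (toHardy u) h = 0 := by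
    linear_combination -h2
  exact (mul_eq_zero.1 h4).resolve_left ((map_ne_zero _).2 h1)

/-- When `E_u(σ) ⊥ u`, the space `E_u(σ)` is orthogonal to the constants and the backward shift maps
it into `F_u(σ)`. -/
lemma inner_mode_zero_and_bshift_mem {u : C(Torus, ℂ)} {σ : ℝ} (hσ : 0 < σ)
    (hE : ∀ h ∈ eigenH u σ, inner ℂ (toHardy u) h = 0) {f : Hardy} (hf : f ∈ eigenH u σ) :
    inner ℂ (mode 0) f = 0 ∧ bshift f ∈ eigenK u σ := by
  have hs : ((σ : ℂ) ^ 2) ≠ 0 := pow_ne_zero _ (ofReal_ne_zero.2 hσ.ne')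
  have hHf := hankel_mem_eigenH hf
  have h1 : f = ((σ : ℂ) ^ 2)⁻¹ • hankel u (hankel u f) := by
    rw [mem_eigenH.1 hf, inv_smul_smul₀ hs]
  constructor
  · rw [h1, Hardy.inner_smul_right, inner_mode_zero_hankel, ← inner_conj_symm, hE _ hHf, map_zero,
      mul_zero]
  · rw [h1, map_smul, ← shiftedHankel_eq_bshift]
    exact Submodule.smul_mem _ _ (shiftedHankel_mem_eigenK
      ((mem_eigenH_iff_of_inner_eq_zero (hE _ hHf)).1 hHf))

lemma bshift_mem_eigenK {u : C(Torus, ℂ)} {σ : ℝ} (hσ : 0 < σ) (hv : projK u σ ≠ 0) {f : Hardy}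
    (hf : f ∈ eigenK u σ) (hfu : inner ℂ (toHardy u) f = 0) :
    inner ℂ (mode 0) f = 0 ∧ bshift f ∈ eigenK u σ :=
  inner_mode_zero_and_bshift_mem hσ (fun _ => inner_eigenH_eq_zero hv)
    ((mem_eigenH_iff_of_inner_eq_zero hfu).2 hf)

/-- If `u ⊥ F_u(σ) ≠ 0`, then `σ ∈ Σ_H(u)` and `E_u(σ)` has dimension at least `2`. -/
lemma crossing_of_projK_eq_zero {u : C(Torus, ℂ)} {σ : ℝ} (hσ : 0 < σ) (hv : projK u σ = 0)
    (hF : eigenK u σ ≠ ⊥) : σ ∈ SigmaH u ∧ 2 ≤ Module.finrank ℂ (eigenH u σ) := by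
  have hfin := finiteDimensional_eigenK u hσ
  have horth : ∀ f ∈ eigenK u σ, inner ℂ (toHardy u) f = 0 := fun f hf => by
    rw [← inner_projK hf, hv, inner_zero_left]
  have hle : eigenK u σ ≤ eigenH u σ := fun f hf =>
    (mem_eigenH_iff_of_inner_eq_zero (horth f hf)).2 hf
  -- Otherwise `E_u(σ)` would be orthogonal to `1` and stable under the backward shift, hence zero,
  -- though it contains `F_u(σ)`.
  have hex : ∃ h ∈ eigenH u σ, inner ℂ (toHardy u) h ≠ 0 := by
    by_contra! hE
    have hinv : ∀ f ∈ (eigenH u σ : Set Hardy), bshift f ∈ (eigenH u σ : Set Hardy) := fun f hf =>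
      hle (inner_mode_zero_and_bshift_mem hσ hE hf).2
    apply hF
    rw [Submodule.eq_bot_iff]
    intro f hf
    exact eq_zero_of_bshift_invariant (E := eigenH u σ)
      (fun f hf => (inner_mode_zero_and_bshift_mem hσ hE hf).1) hinv (hle hf)
  obtain ⟨h, hh, hhu⟩ := hex
  -- Needed because `finrank` is `0` in infinite dimension. The vectors of `E_u(σ)` orthogonal to
  -- `u` lie in `F_u(σ)`, and they have codimension at most one.
  have hfinE : FiniteDimensional ℂ (eigenH u σ) := by
    let ℓ : eigenH u σ →ₗ[ℂ] ℂ := (innerSL ℂ (toHardy u)).toLinearMap ∘ₗ (eigenH u σ).subtype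
    have hker : ∀ f : LinearMap.ker ℓ, ((f : eigenH u σ) : Hardy) ∈ eigenK u σ := fun f =>
      (mem_eigenH_iff_of_inner_eq_zero f.2).1 f.1.2
    have hk : FiniteDimensional ℂ (LinearMap.ker ℓ) :=
      Module.Finite.of_injective
        (LinearMap.codRestrict (eigenK u σ) ((eigenH u σ).subtype ∘ₗ (LinearMap.ker ℓ).subtype) hker)
        (fun a b hab => Subtype.ext (Subtype.ext
          (congrArg (Subtype.val : eigenK u σ → Hardy) hab)))
    have hq : FiniteDimensional ℂ (eigenH u σ ⧸ LinearMap.ker ℓ) :=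
      Module.Finite.equiv ℓ.quotKerEquivRange.symm
    exact Module.Finite.of_submodule_quotient (LinearMap.ker ℓ)
  refine ⟨⟨hσ, fun hort => hhu ?_⟩, ?_⟩
  · exact (Submodule.mem_orthogonal' _ _).1 hort h hh
  · have hlt : eigenK u σ < eigenH u σ :=
      lt_of_le_of_ne hle fun heq => hhu (horth h (heq ▸ hh))
    have h1 := Submodule.finrank_lt_finrank_of_lt hlt
    have h2 : 0 < Module.finrank ℂ (eigenK u σ) := by
      rw [Nat.pos_iff_ne_zero]
      exact fun h0 => hF (Submodule.finrank_eq_zero.1 h0)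
    omega

/-! ### Structure of the eigenspaces of `K_u` -/

/-- `w, z w, …, z ^ (m - 1) w` is a basis of `F_u(σ)`, where `m` is the dimension, and all its
members but the first are orthogonal to `u`. -/
structure IsChain (u : C(Torus, ℂ)) (σ : ℝ) (w : Hardy) : Prop where
  ne_zero : w ≠ 0
  mem : ∀ j < Module.finrank ℂ (eigenK u σ), (shift ^ j) w ∈ eigenK u σ
  orth : ∀ j, 0 < j → j < Module.finrank ℂ (eigenK u σ) →
    inner ℂ (toHardy u) ((shift ^ j) w) = 0

/-- In dimension `n + 1` the `n` conditions `⟨u, S*^j y⟩ = 0`, `j < n`, have a solution `y ≠ 0`.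
Each iterate `S*^j y` then stays in `F_u(σ)`, and those with `j < n` are orthogonal to `1`, so the
shift undoes the backward shift on them. The chain starts at `w = S*^n y`. -/
lemma exists_isChain {u : C(Torus, ℂ)} {σ : ℝ} (hσ : 0 < σ) (hv : projK u σ ≠ 0) :
    ∃ w, IsChain u σ w := by
  have hfin := finiteDimensional_eigenK u hσ
  have hpos : 0 < Module.finrank ℂ (eigenK u σ) := by
    rw [Nat.pos_iff_ne_zero]
    intro h0
    have := (Submodule.eq_bot_iff _).1 (Submodule.finrank_eq_zero.1 h0) _ (projK_mem u σ)
    exact hv this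
  obtain ⟨n, hn⟩ := Nat.exists_eq_succ_of_ne_zero hpos.ne'
  let ℓ : eigenK u σ →ₗ[ℂ] (Fin n → ℂ) := LinearMap.pi fun j =>
    ((innerSL ℂ (toHardy u)) ∘L (bshift ^ (j : ℕ))).toLinearMap ∘ₗ (eigenK u σ).subtype
  have hker : LinearMap.ker ℓ ≠ ⊥ := LinearMap.ker_ne_bot_of_finrank_lt (by simp [hn])
  obtain ⟨y, hy, hy0⟩ := Submodule.exists_mem_ne_zero_of_ne_bot hker
  have hyu : ∀ j < n, inner ℂ (toHardy u) ((bshift ^ j) (y : Hardy)) = 0 := fun j hj =>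
    congrFun (LinearMap.mem_ker.1 hy) ⟨j, hj⟩
  have hsucc : ∀ j, (bshift ^ (j + 1)) (y : Hardy) = bshift ((bshift ^ j) (y : Hardy)) := fun j => by
    rw [pow_succ']; rfl
  have hmem : ∀ j ≤ n, (bshift ^ j) (y : Hardy) ∈ eigenK u σ := by
    intro j
    induction j with
    | zero => exact fun _ => y.2
    | succ j ih =>
      intro hj
      rw [hsucc]
      exact (bshift_mem_eigenK hσ hv (ih (by omega)) (hyu j (by omega))).2
  have hsb : ∀ i ≤ n, (shift ^ i) ((bshift ^ n) (y : Hardy)) = (bshift ^ (n - i)) (y : Hardy) := by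
    intro i
    induction i with
    | zero => exact fun _ => rfl
    | succ i ih =>
      intro hi
      rw [shift_pow_succ_apply, ih (by omega), show n - i = (n - (i + 1)) + 1 by omega, hsucc]
      exact shift_bshift_of_inner_eq_zero
        (bshift_mem_eigenK hσ hv (hmem _ (by omega)) (hyu _ (by omega))).1
  refine ⟨(bshift ^ n) (y : Hardy), ?_, ?_, ?_⟩
  · intro h
    have := hsb n le_rfl
    rw [h, map_zero, Nat.sub_self] at this
    exact hy0 (Subtype.ext this.symm)
  · intro j hj
    rw [hsb j (by omega)]
    exact hmem _ (by omega)
  · intro j hj0 hj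
    rw [hsb j (by omega)]
    exact hyu _ (by omega)

lemma natDegree_lt_of_mem_degreeLT {p : Polynomial ℂ} {m : ℕ} (hm : 0 < m)
    (hp : p ∈ Polynomial.degreeLT ℂ m) : p.natDegree < m := by
  by_cases h : p = 0
  · simpa [h] using hm
  · rw [Polynomial.natDegree_lt_iff_degree_lt h]
    exact Polynomial.mem_degreeLT.1 hp

namespace IsChain

variable {u : C(Torus, ℂ)} {σ : ℝ} {w : Hardy}

/-- Polynomials of degree `< m` inject into `F_u(σ)` through `p ↦ p(S) w`, and the dimensions agree.
-/
lemma exists_polynomial (hw : IsChain u σ w) (hσ : 0 < σ) (hpos : 0 < Module.finrank ℂ (eigenK u σ))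
    {f : Hardy} (hf : f ∈ eigenK u σ) :
    ∃ p : Polynomial ℂ, p.natDegree < Module.finrank ℂ (eigenK u σ) ∧
      f = Polynomial.aeval shift p w := by
  have hfin := finiteDimensional_eigenK u hσ
  set m := Module.finrank ℂ (eigenK u σ) with hm
  let ev : Polynomial ℂ →ₗ[ℂ] Hardy :=
    (ContinuousLinearMap.apply ℂ Hardy w).toLinearMap ∘ₗ (Polynomial.aeval shift).toLinearMap
  have hev : ∀ p : Polynomial.degreeLT ℂ m, (ev ∘ₗ (Polynomial.degreeLT ℂ m).subtype) p
      ∈ eigenK u σ := by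
    intro p
    change Polynomial.aeval shift (p : Polynomial ℂ) w ∈ _
    rw [aeval_apply_eq_sum (natDegree_lt_of_mem_degreeLT hpos p.2)]
    exact Submodule.sum_mem _ fun i hi =>
      Submodule.smul_mem _ _ (hw.mem i (Finset.mem_range.1 hi))
  let φ := LinearMap.codRestrict (eigenK u σ) (ev ∘ₗ (Polynomial.degreeLT ℂ m).subtype) hev
  have hinj : Function.Injective φ := fun p q hpq => Subtype.ext
    (aeval_shift_injective hw.ne_zero (congrArg (Subtype.val : eigenK u σ → Hardy) hpq))
  have hfd : FiniteDimensional ℂ (Polynomial.degreeLT ℂ m) :=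
    Module.Finite.equiv (Polynomial.degreeLTEquiv ℂ m).symm
  have hdim : Module.finrank ℂ (Polynomial.degreeLT ℂ m) = Module.finrank ℂ (eigenK u σ) := by
    rw [(Polynomial.degreeLTEquiv ℂ m).finrank_eq, Module.finrank_fin_fun]
  obtain ⟨p, hp⟩ := (LinearMap.injective_iff_surjective_of_finrank_eq_finrank hdim).1 hinj ⟨f, hf⟩
  exact ⟨p, natDegree_lt_of_mem_degreeLT hpos p.2,
    (congrArg (Subtype.val : eigenK u σ → Hardy) hp).symm⟩

/-- For `i < n`, orthogonality of `z^(i+1) w` to `u` says that `K_u (z^i w) ⊥ 1`; with `K_u S = S*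
K_u` this gives `K_u (z^i w) = z K_u (z^(i+1) w)`. Hence `K_u w = z^n k` with `k = K_u (z^n w)`.
Both are polynomials of degree at most `n` applied to `w`, so `k` is a multiple of `w`. -/
lemma shiftedHankel_shift_pow (hw : IsChain u σ w) (hσ : 0 < σ) {n : ℕ}
    (hn : Module.finrank ℂ (eigenK u σ) = n + 1) :
    ∃ c : ℂ, ‖c‖ = σ ∧ ∀ i ≤ n, shiftedHankel u ((shift ^ i) w) = c • (shift ^ (n - i)) w := by
  set k := shiftedHankel u ((shift ^ n) w) with hk
  have hkm : k ∈ eigenK u σ := shiftedHankel_mem_eigenK (hw.mem n (by omega))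
  have hstep : ∀ i < n, shiftedHankel u ((shift ^ i) w)
      = shift (shiftedHankel u ((shift ^ (i + 1)) w)) := by
    intro i hi
    have h1 : inner ℂ (mode 0) (shiftedHankel u ((shift ^ i) w)) = 0 := by
      rw [shiftedHankel_eq_hankel, inner_mode_zero_hankel, ← shift_pow_succ_apply,
        ← inner_conj_symm, hw.orth _ (by omega) (by omega), map_zero]
    rw [shift_pow_succ_apply, shiftedHankel_shift, shift_bshift_of_inner_eq_zero h1]
  have hdesc : ∀ j ≤ n, shiftedHankel u ((shift ^ (n - j)) w) = (shift ^ j) k := by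
    intro j
    induction j with
    | zero => exact fun _ => rfl
    | succ j ih =>
      intro hj
      rw [hstep _ (by omega), shift_pow_succ_apply j, ← ih (by omega),
        show n - (j + 1) + 1 = n - j by omega]
  obtain ⟨κ, -, hκ⟩ := hw.exists_polynomial hσ (by omega) hkm
  have hw0 : w ∈ eigenK u σ := hw.mem 0 (by omega)
  have hKw : shiftedHankel u w = (shift ^ n) k := by
    rw [← hdesc n le_rfl, Nat.sub_self]; rfl
  obtain ⟨η, hηd, hη⟩ := hw.exists_polynomial hσ (by omega) (shiftedHankel_mem_eigenK hw0)
  have hpoly : Polynomial.X ^ n * κ = η := by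
    apply aeval_shift_injective hw.ne_zero
    rw [← hη, hKw, aeval_mul_apply, ← hκ, map_pow, Polynomial.aeval_X]
  have hκ0 : κ.natDegree = 0 := by
    by_cases h0 : κ = 0
    · rw [h0, Polynomial.natDegree_zero]
    · rw [← hpoly, Polynomial.natDegree_mul (pow_ne_zero _ Polynomial.X_ne_zero) h0,
        Polynomial.natDegree_X_pow, hn] at hηd
      omega
  rw [Polynomial.eq_C_of_natDegree_eq_zero hκ0, aeval_C_apply] at hκ
  refine ⟨κ.coeff 0, ?_, ?_⟩
  · have h1 := norm_shiftedHankel_of_mem hσ.le (hw.mem n (by omega))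
    rw [← hk, hκ, norm_smul, norm_shift_pow] at h1
    exact mul_right_cancel₀ (norm_ne_zero_iff.2 hw.ne_zero) h1
  · intro i hi
    have := hdesc (n - i) (Nat.sub_le _ _)
    rw [Nat.sub_sub_self hi] at this
    rw [this, hκ, map_smul]

/-- The polynomial expressing `u'_σ` has no roots in the closed unit disc. -/
lemma one_lt_norm_of_root (hw : IsChain u σ w) {Q : Polynomial ℂ}
    (hQ : Q.natDegree < Module.finrank ℂ (eigenK u σ))
    (hQv : projK u σ = Polynomial.aeval shift Q w) (hv : projK u σ ≠ 0) {a : ℂ}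
    (ha : Q.eval a = 0) : 1 < ‖a‖ := by
  obtain ⟨R, rfl⟩ := Polynomial.dvd_iff_isRoot.2 ha
  have hR : R ≠ 0 := by
    rintro rfl
    exact hv (by rw [hQv, mul_zero, map_zero]; rfl)
  rw [Polynomial.natDegree_mul (Polynomial.X_sub_C_ne_zero a) hR,
    Polynomial.natDegree_X_sub_C] at hQ
  set g := Polynomial.aeval shift R w with hg
  have hvg : projK u σ = shift g - a • g := by
    rw [hQv, aeval_mul_apply, aeval_X_sub_C_apply]
  -- `z g` is a combination of `z w, …, z^n w`. Pythagoras for `a g = z g - u'` then gives `|a|²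
  -- ‖g‖² = ‖g‖² + ‖u'‖²`.
  have horth : inner ℂ (projK u σ) (shift g) = 0 := by
    rw [hg, aeval_apply_eq_sum (Nat.lt_succ_self _), map_sum, inner_sum]
    refine Finset.sum_eq_zero fun i hi => ?_
    rw [Finset.mem_range] at hi
    rw [map_smul, ← shift_pow_succ_apply, Hardy.inner_smul_right,
      inner_projK (hw.mem _ (by omega)), hw.orth _ (by omega) (by omega), mul_zero]
  have hpyth : ‖a • g‖ * ‖a • g‖ = ‖shift g‖ * ‖shift g‖ + ‖projK u σ‖ * ‖projK u σ‖ := by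
    have h1 : a • g = shift g + -projK u σ := by rw [hvg]; abel
    have h2 : inner ℂ (shift g) (-projK u σ) = 0 := by
      rw [inner_neg_right, ← inner_conj_symm, horth, map_zero, neg_zero]
    rw [h1, norm_add_sq_eq_norm_sq_add_norm_sq_of_inner_eq_zero (𝕜 := ℂ) _ _ h2, norm_neg]
  rw [norm_shift, norm_smul] at hpyth
  have hg0 : 0 < ‖g‖ := norm_pos_iff.2 (aeval_shift_ne_zero hR hw.ne_zero)
  have hv0 : 0 < ‖projK u σ‖ := norm_pos_iff.2 hv
  by_contra! hle
  have h2 : ‖a‖ * ‖g‖ ≤ ‖g‖ := mul_le_of_le_one_left hg0.le hle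
  have h3 : ‖a‖ * ‖g‖ * (‖a‖ * ‖g‖) ≤ ‖g‖ * ‖g‖ := mul_self_le_mul_self (by positivity) h2
  nlinarith [mul_pos hv0 hv0]

/-- A chain yields the Blaschke factor, whose zeros are read off from the polynomial which expresses
`u'_σ`. -/
lemma exists_blaschkeFactor (hw : IsChain u σ w) (hσ : 0 < σ) {n : ℕ}
    (hn : Module.finrank ℂ (eigenK u σ) = n + 1) {Q : Polynomial ℂ} (hQ : Q.natDegree ≤ n)
    (hQv : projK u σ = Polynomial.aeval shift Q w) (hv : projK u σ ≠ 0) :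
    ∃ Ψ : BlaschkeProduct, IsBlaschkeFactor u σ Ψ ∧ Ψ.degree = n ∧
      Ψ.P = Polynomial.C (conj (Q.coeff 0))⁻¹ * (Q.map (starRingEnd ℂ)).reflect n := by
  obtain ⟨c, hc, hK⟩ := hw.shiftedHankel_shift_pow hσ hn
  have hroots : ∀ a, Q.eval a = 0 → 1 < ‖a‖ := fun a =>
    hw.one_lt_norm_of_root (by omega) hQv hv
  have h0 : Q.coeff 0 ≠ 0 := by
    intro h
    rw [Polynomial.coeff_zero_eq_eval_zero] at h
    have := hroots 0 h
    norm_num at this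
  have h0' : conj (Q.coeff 0) ≠ 0 := (map_ne_zero _).2 h0
  have hs : (σ : ℂ) ≠ 0 := ofReal_ne_zero.2 hσ.ne'
  have hKv : shiftedHankel u (projK u σ)
      = Polynomial.aeval shift (Polynomial.C c * (Q.map (starRingEnd ℂ)).reflect n) w := by
    have hdeg : ((Q.map (starRingEnd ℂ)).reflect n).natDegree < n + 1 := by
      refine Nat.lt_succ_of_le (Polynomial.natDegree_reflect_le.trans ?_)
      rw [Polynomial.natDegree_map]
      exact (max_eq_left hQ).le
    rw [hQv, aeval_apply_eq_sum (Nat.lt_succ_of_le hQ), map_sum, aeval_mul_apply, aeval_C_apply,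
      aeval_apply_eq_sum hdeg, Finset.smul_sum, ← Finset.sum_range_reflect]
    refine Finset.sum_congr rfl fun i hi => ?_
    have hi' : i ≤ n := Nat.lt_succ_iff.1 (Finset.mem_range.1 hi)
    rw [map_smulₛₗ, hK _ (by omega), Polynomial.coeff_reflect, Polynomial.revAt_le hi',
      Polynomial.coeff_map, smul_comm, show n + 1 - 1 - i = n - i by omega,
      Nat.sub_sub_self hi']
  -- `e` collects the factors that make `P` monic and give `D` constant term `1`. The angle is `-arg
  -- e` because a Blaschke product carries `e^{-iψ}`.
  set e : ℂ := c * conj (Q.coeff 0) / (σ * Q.coeff 0) with he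
  have hnorm : ‖e‖ = 1 := by
    rw [he, norm_div, norm_mul, norm_mul, Complex.norm_conj, hc, Complex.norm_real,
      Real.norm_of_nonneg hσ.le, div_self]
    exact mul_ne_zero hσ.ne' (norm_ne_zero_iff.2 h0)
  obtain ⟨Ψ, hang, hdeg, hP, hD⟩ := BlaschkeProduct.exists_of_roots hQ hroots (-(Complex.arg e : Real.Angle))
  refine ⟨Ψ, ?_, hdeg, hP⟩
  have hcirc : ((-Ψ.angle).toCircle : ℂ) = e := by
    rw [hang, neg_neg, Real.Angle.toCircle_coe, Circle.coe_exp]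
    have := Complex.norm_mul_exp_arg_mul_I e
    rwa [hnorm, ofReal_one, one_mul] at this
  have hcoe := coeFn_aeval (Polynomial.C c * (Q.map (starRingEnd ℂ)).reflect n) w
  rw [← hKv] at hcoe
  have hcoe' := coeFn_aeval Q w
  rw [← hQv] at hcoe'
  filter_upwards [hcoe, hcoe'] with x h1 h2
  have hDx := Ψ.D_eval_fourier_ne_zero x
  rw [hD, Polynomial.eval_mul, Polynomial.eval_C] at hDx
  have hQx := right_ne_zero_of_mul hDx
  rw [h1, h2]
  simp only [BlaschkeProduct.eval]
  rw [hcirc, hD, hP, he]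
  simp only [Polynomial.eval_mul, Polynomial.eval_C]
  field_simp

end IsChain

/-- At a time with `σ ∈ Σ_K(u)` the Blaschke factor exists and has degree `dim F_u(σ) - 1`. -/
lemma exists_isBlaschkeFactor {u : C(Torus, ℂ)} {σ : ℝ} (hσ : 0 < σ) (hv : projK u σ ≠ 0) :
    ∃ (w : Hardy) (n : ℕ) (Q : Polynomial ℂ) (Ψ : BlaschkeProduct), IsChain u σ w ∧
      Module.finrank ℂ (eigenK u σ) = n + 1 ∧ Q.natDegree ≤ n ∧ Q.coeff 0 ≠ 0 ∧
      projK u σ = Polynomial.aeval shift Q w ∧ IsBlaschkeFactor u σ Ψ ∧ Ψ.degree = n ∧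
      Ψ.P = Polynomial.C (conj (Q.coeff 0))⁻¹ * (Q.map (starRingEnd ℂ)).reflect n := by
  obtain ⟨w, hw⟩ := exists_isChain hσ hv
  have hfin := finiteDimensional_eigenK u hσ
  have hpos : Module.finrank ℂ (eigenK u σ) ≠ 0 := by
    intro h0
    exact hv ((Submodule.eq_bot_iff _).1 (Submodule.finrank_eq_zero.1 h0) _ (projK_mem u σ))
  obtain ⟨n, hn⟩ := Nat.exists_eq_succ_of_ne_zero hpos
  obtain ⟨Q, hQd, hQv⟩ := hw.exists_polynomial hσ (by omega) (projK_mem u σ)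
  obtain ⟨Ψ, h1, h2, h3⟩ := hw.exists_blaschkeFactor hσ hn (by omega) hQv hv
  refine ⟨w, n, Q, Ψ, hw, hn, by omega, ?_, hQv, h1, h2, h3⟩
  intro h
  rw [Polynomial.coeff_zero_eq_eval_zero] at h
  have := hw.one_lt_norm_of_root (by omega) hQv hv h
  norm_num at this

/-! ### Linear differential equations in a Banach space -/

section LinearODE

variable {E : Type*} [NormedAddCommGroup E] [NormedSpace ℝ E]

lemma eq_zero_of_norm_deriv_le_right {f f' : ℝ → E} {k : ℝ → ℝ} (hk : Continuous k)
    (hf : ∀ t, HasDerivAt f (f' t) t) (hle : ∀ t, ‖f' t‖ ≤ k t * ‖f t‖) {t₀ t : ℝ}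
    (h0 : f t₀ = 0) (ht : t₀ ≤ t) : f t = 0 := by
  obtain ⟨M, hM⟩ := (isCompact_Icc (a := t₀) (b := t)).exists_bound_of_continuousOn hk.continuousOn
  have h := norm_le_gronwallBound_of_norm_deriv_right_le (f := f) (f' := f') (δ := 0) (K := M)
    (ε := 0) (a := t₀) (b := t) (fun x _ => (hf x).continuousAt.continuousWithinAt)
    (fun x _ => (hf x).hasDerivWithinAt) (by simp [h0])
    (fun x hx => by
      rw [add_zero]
      refine (hle x).trans (mul_le_mul_of_nonneg_right ?_ (norm_nonneg _))
      exact (le_abs_self _).trans (hM x ⟨hx.1, hx.2.le⟩))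
    t ⟨ht, le_rfl⟩
  rw [gronwallBound_ε0_δ0] at h
  exact norm_le_zero_iff.1 h

lemma eq_zero_of_norm_deriv_le {f f' : ℝ → E} {k : ℝ → ℝ} (hk : Continuous k)
    (hf : ∀ t, HasDerivAt f (f' t) t) (hle : ∀ t, ‖f' t‖ ≤ k t * ‖f t‖) {t₀ : ℝ}
    (h0 : f t₀ = 0) (t : ℝ) : f t = 0 := by
  rcases le_total t₀ t with ht | ht
  · exact eq_zero_of_norm_deriv_le_right hk hf hle h0 ht
  · have := eq_zero_of_norm_deriv_le_right (f := fun s => f (-s)) (f' := fun s => -f' (-s))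
      (k := fun s => k (-s)) (t₀ := -t₀) (t := -t) (by fun_prop)
      (fun s => by
        have := (hf (-s)).scomp s (hasDerivAt_neg s)
        rw [neg_one_smul] at this
        exact this)
      (fun s => by rw [norm_neg]; exact hle (-s)) (by rw [neg_neg, h0]) (neg_le_neg ht)
    simpa using this

/-- The terms of the Dyson series. -/
noncomputable def dyson (A : ℝ → E →L[ℝ] E) (t₀ : ℝ) (x : E) : ℕ → ℝ → E
  | 0 => fun _ => x
  | n + 1 => fun t => ∫ s in t₀..t, A s (dyson A t₀ x n s)

lemma continuous_dyson {A : ℝ → E →L[ℝ] E} (hA : Continuous A) (t₀ : ℝ) (x : E) (n : ℕ) :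
    Continuous (dyson A t₀ x n) := by
  induction n with
  | zero => exact continuous_const
  | succ n ih =>
    exact intervalIntegral.continuous_primitive
      (fun a b => (hA.clm_apply ih).intervalIntegrable a b) t₀

/-- Integrating `|s - t₀|^n` at each step produces the factorial, so the series converges for every
length of time. -/
lemma norm_dyson_le {A : ℝ → E →L[ℝ] E} (hA : Continuous A) {t₀ R M : ℝ} (x : E)
    (hM : ∀ t ∈ Metric.ball t₀ R, ‖A t‖ ≤ M) (n : ℕ) {t : ℝ} (ht : t ∈ Metric.ball t₀ R) :
    ‖dyson A t₀ x n t‖ ≤ ‖x‖ * M ^ n / n.factorial * |t - t₀| ^ n := by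
  induction n generalizing t with
  | zero => simp [dyson]
  | succ n ih =>
    have hM0 : 0 ≤ M := (norm_nonneg _).trans (hM t ht)
    have hR : 0 < R := (dist_nonneg).trans_lt (Metric.mem_ball.1 ht)
    have hsub : Set.uIoc t₀ t ⊆ Metric.ball t₀ R := by
      refine Set.uIoc_subset_uIcc.trans ?_
      rw [← segment_eq_uIcc]
      exact (convex_ball t₀ R).segment_subset (Metric.mem_ball_self hR) ht
    have hcont : Continuous fun s => A s (dyson A t₀ x n s) :=
      hA.clm_apply (continuous_dyson hA t₀ x n)
    have h1 : ‖dyson A t₀ x (n + 1) t‖ ≤ ∫ s in Set.uIoc t₀ t, ‖A s (dyson A t₀ x n s)‖ :=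
      intervalIntegral.norm_integral_le_integral_norm_uIoc
    have h2 : ∫ s in Set.uIoc t₀ t, ‖A s (dyson A t₀ x n s)‖
        ≤ ∫ s in Set.uIoc t₀ t, (‖x‖ * M ^ (n + 1) / n.factorial) * |s - t₀| ^ n := by
      refine setIntegral_mono_on ?_ ?_ measurableSet_uIoc fun s hs => ?_
      · exact (hcont.norm.intervalIntegrable t₀ t).def'
      · exact ((by fun_prop : Continuous fun s : ℝ =>
          (‖x‖ * M ^ (n + 1) / n.factorial) * |s - t₀| ^ n).intervalIntegrable t₀ t).def'
      · calc ‖A s (dyson A t₀ x n s)‖ ≤ ‖A s‖ * ‖dyson A t₀ x n s‖ := (A s).le_opNorm _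
          _ ≤ M * (‖x‖ * M ^ n / n.factorial * |s - t₀| ^ n) :=
            mul_le_mul (hM s (hsub hs)) (ih (hsub hs)) (norm_nonneg _) hM0
          _ = _ := by ring
    refine h1.trans (h2.trans_eq ?_)
    rw [integral_const_mul, integral_pow_abs_sub_uIoc, Nat.factorial_succ]
    push_cast
    have : (n.factorial : ℝ) ≠ 0 := by positivity
    have : (n : ℝ) + 1 ≠ 0 := by positivity
    field_simp

/-- A linear differential equation with continuous coefficients has global solutions. -/
lemma exists_linear_solution [CompleteSpace E] {A : ℝ → E →L[ℝ] E} (hA : Continuous A) (t₀ : ℝ)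
    (x : E) : ∃ f : ℝ → E, f t₀ = x ∧ ∀ t, HasDerivAt f (A t (f t)) t := by
  refine ⟨fun t => ∑' n, dyson A t₀ x n t, ?_, fun t => ?_⟩
  · have h : ∀ n, n ≠ 0 → dyson A t₀ x n t₀ = 0 := by
      rintro (_ | n) hn
      · exact absurd rfl hn
      · exact intervalIntegral.integral_same
    exact tsum_eq_single 0 h
  -- The series is differentiated term by term on a ball about `t₀` that contains `t`, where `A` is
  -- bounded by compactness.
  set R : ℝ := dist t t₀ + 1 with hR
  have htR : t ∈ Metric.ball t₀ R := Metric.mem_ball.2 (lt_add_one _)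
  obtain ⟨M, hM⟩ := (isCompact_closedBall t₀ R).exists_bound_of_continuousOn hA.continuousOn
  have hMb : ∀ s ∈ Metric.ball t₀ R, ‖A s‖ ≤ M := fun s hs => hM s (Metric.ball_subset_closedBall hs)
  have hM0 : 0 ≤ M := (norm_nonneg _).trans (hMb t htR)
  have hbound : ∀ n, ∀ s ∈ Metric.ball t₀ R,
      ‖dyson A t₀ x n s‖ ≤ ‖x‖ * ((M * R) ^ n / n.factorial) := by
    intro n s hs
    refine (norm_dyson_le hA x hMb n hs).trans ?_
    have h1 : |s - t₀| ≤ R := (Metric.mem_ball.1 hs).le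
    calc ‖x‖ * M ^ n / n.factorial * |s - t₀| ^ n ≤ ‖x‖ * M ^ n / n.factorial * R ^ n := by gcongr
      _ = _ := by rw [mul_pow]; ring
  have hsum : Summable fun n : ℕ => ‖x‖ * ((M * R) ^ n / n.factorial) :=
    (Real.summable_pow_div_factorial _).mul_left _
  let g' : ℕ → ℝ → E
    | 0 => fun _ => 0
    | n + 1 => fun s => A s (dyson A t₀ x n s)
  let b : ℕ → ℝ
    | 0 => 0
    | n + 1 => M * (‖x‖ * ((M * R) ^ n / n.factorial))
  have hb : Summable b := (summable_nat_add_iff 1).1 (hsum.mul_left M)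
  have hg : ∀ n s, s ∈ Metric.ball t₀ R → HasDerivAt (dyson A t₀ x n) (g' n s) s := by
    rintro (_ | n) s -
    · exact hasDerivAt_const s x
    · exact ((hA.clm_apply (continuous_dyson hA t₀ x n)).integral_hasStrictDerivAt t₀ s).hasDerivAt
  have hg' : ∀ n s, s ∈ Metric.ball t₀ R → ‖g' n s‖ ≤ b n := by
    rintro (_ | n) s hs
    · exact norm_zero.le
    · exact ((A s).le_opNorm _).trans
        (mul_le_mul (hMb s hs) (hbound n s hs) (norm_nonneg _) hM0)
  have hsumt : Summable fun n => dyson A t₀ x n t :=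
    Summable.of_norm_bounded hsum fun n => hbound n t htR
  have key := hasDerivAt_tsum_of_isPreconnected hb Metric.isOpen_ball
    (convex_ball t₀ R).isPreconnected hg hg' htR hsumt htR
  have hval : ∑' n, g' n t = A t (∑' n, dyson A t₀ x n t) := by
    rw [(Summable.of_norm_bounded hb fun n => hg' n t htR).tsum_eq_zero_add,
      (A t).map_tsum hsumt]
    exact zero_add _
  rw [← hval]
  exact key

end LinearODE

/-! ### Sobolev functions -/

/-- Comparison with `|n|^(-2s)` away from `n = 0`. -/
lemma summable_sobolev_weight {s : ℝ} (hs : 1 / 2 < s) :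
    Summable fun n : ℤ => ((1 + (n : ℝ) ^ 2) ^ s)⁻¹ := by
  refine Summable.of_norm_bounded_eventually
    (Real.summable_abs_int_rpow (b := 2 * s) (by linarith)) ?_
  filter_upwards [(Set.finite_singleton (0 : ℤ)).compl_mem_cofinite] with n hn
  have hn0 : (n : ℝ) ≠ 0 := by exact_mod_cast hn
  have habs : 0 < |(n : ℝ)| := abs_pos.2 hn0
  rw [Real.norm_of_nonneg (by positivity), ← Real.rpow_neg (by positivity),
    show -(2 * s) = (2 : ℕ) * (-s) by push_cast; ring, Real.rpow_mul habs.le, Real.rpow_natCast,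
    sq_abs]
  exact Real.rpow_le_rpow_of_nonpos (by positivity) (by linarith) (by linarith)

/-- The sup norm is at most `∑ |f̂(n)|`. Instead of Cauchy–Schwarz, each term is bounded by `c ≤ δ/a
+ a c²/(4δ)`, with `a` the Sobolev weight. -/
lemma norm_le_of_sobolev {s : ℝ} (hs : 1 / 2 < s) {f : C(Torus, ℂ)} (hf : sobolevNormSq s f < ∞)
    {δ : ℝ} (hδ : 0 < δ) :
    ‖f‖ ≤ δ * (∑' n : ℤ, ((1 + (n : ℝ) ^ 2) ^ s)⁻¹) + (sobolevNormSq s f).toReal / (4 * δ) := by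
  have hnn : ∀ n : ℤ, 0 ≤ (1 + (n : ℝ) ^ 2) ^ s * ‖fourierCoeff f n‖ ^ 2 := fun n => by positivity
  have h1 : Summable fun n : ℤ => (1 + (n : ℝ) ^ 2) ^ s * ‖fourierCoeff f n‖ ^ 2 := by
    have := ENNReal.summable_toReal hf.ne
    refine this.congr fun n => ENNReal.toReal_ofReal (hnn n)
  have h2 : (sobolevNormSq s f).toReal
      = ∑' n : ℤ, (1 + (n : ℝ) ^ 2) ^ s * ‖fourierCoeff f n‖ ^ 2 := by
    unfold sobolevNormSq
    rw [ENNReal.tsum_toReal_eq fun n => ENNReal.ofReal_ne_top]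
    exact tsum_congr fun n => ENNReal.toReal_ofReal (hnn n)
  have hw := summable_sobolev_weight hs
  have hle : ∀ n : ℤ, ‖fourierCoeff f n‖ ≤ δ * ((1 + (n : ℝ) ^ 2) ^ s)⁻¹
      + (1 + (n : ℝ) ^ 2) ^ s * ‖fourierCoeff f n‖ ^ 2 / (4 * δ) := by
    intro n
    set a : ℝ := (1 + (n : ℝ) ^ 2) ^ s with ha
    have ha0 : 0 < a := by positivity
    set c := ‖fourierCoeff f n‖
    have : δ * a⁻¹ + a * c ^ 2 / (4 * δ) - c = (2 * δ - a * c) ^ 2 / (4 * δ * a) := by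
      field_simp
      ring
    have h3 : 0 ≤ (2 * δ - a * c) ^ 2 / (4 * δ * a) := by positivity
    linarith
  have hsum : Summable (fourierCoeff f) :=
    Summable.of_norm_bounded ((hw.mul_left δ).add (h1.div_const (4 * δ))) hle
  refine (hasSum_fourier_series_of_summable hsum).norm_le_of_bounded
    (g := fun n : ℤ => δ * ((1 + (n : ℝ) ^ 2) ^ s)⁻¹
      + (1 + (n : ℝ) ^ 2) ^ s * ‖fourierCoeff f n‖ ^ 2 / (4 * δ)) ?_ fun n => ?_
  · rw [h2]
    exact (hw.hasSum.mul_left δ).add (h1.hasSum.div_const (4 * δ))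
  · rw [norm_smul, fourier_norm, mul_one]
    exact hle n

lemma IsSolution.continuous_uniform {α s : ℝ} (hs : 1 / 2 < s) {u : ℝ → C(Torus, ℂ)}
    (hu : IsSolution α s u) : Continuous u := by
  rw [continuous_iff_continuousAt]
  intro t₀
  rw [ContinuousAt, tendsto_iff_norm_sub_tendsto_zero, Metric.tendsto_nhds]
  intro ε hε
  set W : ℝ := ∑' n : ℤ, ((1 + (n : ℝ) ^ 2) ^ s)⁻¹ with hW
  have hW0 : 0 ≤ W := tsum_nonneg fun n => by positivity
  -- First `δ` makes the weight term smaller than `ε/2`; then a squared Sobolev norm below `2δε`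
  -- makes the other term smaller than `ε/2`.
  set δ : ℝ := ε / (2 * (W + 1)) with hδ
  have hδ0 : 0 < δ := by positivity
  have h1 : δ * W < ε / 2 := by
    rw [hδ, div_mul_eq_mul_div, div_lt_div_iff₀ (by positivity) (by positivity)]
    nlinarith
  have hev : ∀ᶠ t in 𝓝 t₀, sobolevNormSq s (u t - u t₀) < ENNReal.ofReal (2 * δ * ε) :=
    (hu.continuous t₀).eventually_lt_const (by positivity)
  filter_upwards [hev] with t ht
  have hlt : (sobolevNormSq s (u t - u t₀)).toReal < 2 * δ * ε := by
    rw [← ENNReal.lt_ofReal_iff_toReal_lt (ht.trans ENNReal.ofReal_lt_top).ne]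
    exact ht
  have h2 := norm_le_of_sobolev hs (ht.trans ENNReal.ofReal_lt_top) hδ0
  have h3 : (sobolevNormSq s (u t - u t₀)).toReal / (4 * δ) < ε / 2 := by
    rw [div_lt_iff₀ (by positivity)]
    linarith
  rw [dist_zero_right, norm_norm]
  linarith

lemma SobolevPlus.toL2_mem {s : ℝ} {f : C(Torus, ℂ)} (hf : f ∈ SobolevPlus s) :
    toL2 f ∈ hardySubmodule := by
  intro n hn
  rw [fourierCoeff_toL2]
  exact hf.1 n hn

/-! ### The Lax operator -/

/-- `(u, f) ↦ K_u f` as a real bilinear map. -/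
noncomputable def hankelBilin : C(Torus, ℂ) →L[ℝ] Hardy →L[ℝ] Hardy :=
  LinearMap.mkContinuous₂
    (LinearMap.mk₂ ℝ (fun u f => shiftedHankel u f) shiftedHankel_add
      (fun c u f => shiftedHankel_smul (c : ℂ) u f) (fun u f g => map_add _ f g)
      (fun c u f => by
        change shiftedHankel u ((c : ℂ) • f) = (c : ℂ) • shiftedHankel u f
        rw [map_smulₛₗ, conj_ofReal]))
    1 (fun u f => by rw [one_mul]; exact norm_shiftedHankel_le u f)

/-- `(b, f) ↦ T_b f` as a real bilinear map. -/
noncomputable def toeplitzBilin : C(Torus, ℂ) →L[ℝ] Hardy →L[ℝ] Hardy :=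
  LinearMap.mkContinuous₂
    (LinearMap.mk₂ ℝ (fun u f => toeplitz u f) toeplitz_add
      (fun c u f => toeplitz_smul (c : ℂ) u f) (fun u f g => map_add _ f g)
      (fun c u f => (toeplitz u).map_smul (c : ℂ) f))
    1 (fun u f => by rw [one_mul]; exact norm_toeplitz_le u f)

/-- The skew-adjoint operator `-i T_{|u|²} + (i/2) K_u²` of the Lax pair. -/
noncomputable def lax (u : C(Torus, ℂ)) : Hardy →L[ℂ] Hardy :=
  (-I) • toeplitz (star u * u) + (I / 2) • (shiftedHankel u).comp (shiftedHankel u)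

lemma lax_apply (u : C(Torus, ℂ)) (f : Hardy) :
    lax u f = (-I) • toeplitz (star u * u) f + (I / 2) • shiftedHankel u (shiftedHankel u f) := rfl

lemma inner_shiftedHankel_sq (u : C(Torus, ℂ)) (f g : Hardy) :
    inner ℂ (shiftedHankel u (shiftedHankel u f)) g
      = inner ℂ f (shiftedHankel u (shiftedHankel u g)) := by
  rw [← inner_conj_symm, inner_shiftedHankel_symm, inner_shiftedHankel_symm u _ f, inner_conj_symm]

lemma conj_I_div_two : conj (I / 2) = -(I / 2) := by
  rw [map_div₀, conj_I, map_ofNat, neg_div]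

/-- `T_{|u|²}` and `K_u²` are self-adjoint and their coefficients are imaginary. -/
lemma inner_lax (u : C(Torus, ℂ)) (f g : Hardy) :
    inner ℂ (lax u f) g = -inner ℂ f (lax u g) := by
  have hb : star (star u * u) = star u * u := by rw [star_mul, star_star]
  rw [lax_apply, lax_apply, inner_add_left, inner_add_right, Hardy.inner_smul_left,
    Hardy.inner_smul_left, Hardy.inner_smul_right, Hardy.inner_smul_right,
    inner_toeplitz_symm hb, inner_shiftedHankel_sq, conj_I_div_two, map_neg, conj_I]
  ring

/-- The Lax operator as a real linear operator. -/
noncomputable def laxReal (u : C(Torus, ℂ)) : Hardy →L[ℝ] Hardy :=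
  (-I) • toeplitzBilin (star u * u) + (I / 2) • (hankelBilin u).comp (hankelBilin u)

-- Continuity in operator norm is what the linear equation requires. It is stated over `ℝ` because
-- `K_u` is antilinear.
set_option synthInstance.maxHeartbeats 200000 in
lemma continuous_laxReal : Continuous laxReal := by
  unfold laxReal
  refine Continuous.add ?_ ?_
  · exact (toeplitzBilin.continuous.comp (by fun_prop)).const_smul (-I)
  · exact (hankelBilin.continuous.clm_comp hankelBilin.continuous).const_smul (I / 2)

lemma bshift_lax {u : C(Torus, ℂ)} {f : Hardy} (h1 : inner ℂ (mode 0) f = 0)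
    (hu : inner ℂ (toHardy u) f = 0) : bshift (lax u f) = lax u (bshift f) := by
  rw [lax_apply, lax_apply, map_add, map_smul, map_smul, bshift_toeplitz h1,
    bshift_shiftedHankel_sq h1 hu]

/-- The Lax identity `-i K_{|u|²u} = [C_u, K_u]`. -/
lemma lax_shiftedHankel {u : C(Torus, ℂ)} (hu : toL2 u ∈ hardySubmodule) (f : Hardy) :
    shiftedHankel ((-I) • (star u * u * u)) f + shiftedHankel u (lax u f)
      = lax u (shiftedHankel u f) := by
  rw [shiftedHankel_smul, shiftedHankel_cubic hu, lax_apply, lax_apply, map_add, map_smulₛₗ,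
    map_smulₛₗ]
  -- Antilinearity flips the sign of the coefficients inside `K_u`: the `K_u T_{|u|²}` terms cancel,
  -- and `i K_u³ - (i/2) K_u³` leaves the `(i/2) K_u³` of the right side.
  have h1 : conj (-I) = I := by simp
  rw [h1, conj_I_div_two]
  module

/-! ### The flow of the Lax operator -/

/-- The matrix entries of `K_a` are the coefficients of index `n + m + 1`. So the zero mode, where
the `α` term lives, is invisible, as are the negative ones. -/
lemma shiftedHankel_congr {a b : C(Torus, ℂ)}
    (h : ∀ n : ℕ, inner ℂ (mode (n + 1)) (toHardy a) = inner ℂ (mode (n + 1)) (toHardy b))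
    (f : Hardy) : shiftedHankel a f = shiftedHankel b f := by
  have h1 : ∀ (c : C(Torus, ℂ)) (m n : ℕ), inner ℂ (mode m) (shiftedHankel c (mode n))
      = inner ℂ (mode (n + m + 1)) (toHardy c) := by
    intro c m n
    rw [shiftedHankel_eq_hankel, shift_mode, inner_hankel_mode, inner_toHardy]
    change inner ℂ (toL2 (fourier (m : ℤ))) _ = inner ℂ (toL2 (fourier ((n + m + 1 : ℕ) : ℤ))) _
    rw [mul_comm c, ← mulL2_toL2, ← star_star (fourier (-((n + 1 : ℕ) : ℤ))), ← inner_mulL2_left,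
      star_fourier, mulL2_toL2, fourier_mul_fourier, neg_neg]
    congr 3
    push_cast
    ring
  have h2 : ∀ n, shiftedHankel a (mode n) = shiftedHankel b (mode n) := fun n =>
    Hardy.eq_of_modes fun m => by rw [h1, h1, h]
  apply Hardy.eq_of_modes
  intro n
  rw [inner_shiftedHankel_symm, h2, inner_shiftedHankel_symm]

/-- A solution of the linear equation `f' = C_u f`. -/
def IsFlow (u : ℝ → C(Torus, ℂ)) (f : ℝ → Hardy) : Prop :=
  ∀ t, HasDerivAt f (lax (u t) (f t)) t

namespace IsFlow

variable {u : ℝ → C(Torus, ℂ)} {f g : ℝ → Hardy}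

lemma exists_of_initial (hu : Continuous u) (t₀ : ℝ) (x : Hardy) :
    ∃ f, f t₀ = x ∧ IsFlow u f :=
  exists_linear_solution (continuous_laxReal.comp hu) t₀ x

lemma smul (c : ℂ) (hf : IsFlow u f) : IsFlow u (fun t => c • f t) := fun t => by
  rw [map_smul]
  exact (hf t).const_smul c

lemma sub (hf : IsFlow u f) (hg : IsFlow u g) : IsFlow u (fun t => f t - g t) := fun t => by
  rw [map_sub]
  exact (hf t).sub (hg t)

lemma inner_const (hf : IsFlow u f) (hg : IsFlow u g) (t t₀ : ℝ) :
    inner ℂ (f t) (g t) = inner ℂ (f t₀) (g t₀) := by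
  have h : ∀ s, HasDerivAt (fun t => inner ℂ (f t) (g t)) 0 s := fun s => by
    have h1 := HasDerivAt.inner ℂ (hf s) (hg s)
    have h2 : inner ℂ (f s) (lax (u s) (g s)) + inner ℂ (lax (u s) (f s)) (g s) = 0 := by
      rw [inner_lax, add_neg_cancel]
    rwa [← h2]
  exact is_const_of_deriv_eq_zero (fun s => (h s).differentiableAt) (fun s => (h s).deriv) t t₀

lemma norm_const (hf : IsFlow u f) (t t₀ : ℝ) : ‖f t‖ = ‖f t₀‖ := by
  rw [← sq_eq_sq₀ (norm_nonneg _) (norm_nonneg _), @norm_sq_eq_re_inner ℂ, @norm_sq_eq_re_inner ℂ]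
  exact congrArg _ (hf.inner_const hf t t₀)

/-- The matrix coefficients of the backward shift along the flow are constant on the functions
orthogonal to `1` and to `u`. -/
lemma inner_bshift_const (hf : IsFlow u f) (hg : IsFlow u g)
    (h1 : ∀ t, inner ℂ (mode 0) (f t) = 0) (hu : ∀ t, inner ℂ (toHardy (u t)) (f t) = 0)
    (t t₀ : ℝ) : inner ℂ (g t) (bshift (f t)) = inner ℂ (g t₀) (bshift (f t₀)) := by
  have h : ∀ s, HasDerivAt (fun t => inner ℂ (g t) (bshift (f t))) 0 s := fun s => by
    have h0 : HasDerivAt (fun t => bshift (f t)) (bshift (lax (u s) (f s))) s :=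
      (bshift.restrictScalars ℝ).hasFDerivAt.comp_hasDerivAt s (hf s)
    have hd := HasDerivAt.inner ℂ (hg s) h0
    have h2 : inner ℂ (g s) (bshift (lax (u s) (f s)))
        + inner ℂ (lax (u s) (g s)) (bshift (f s)) = 0 := by
      rw [inner_lax, bshift_lax (h1 s) (hu s), add_neg_cancel]
    rwa [← h2]
  exact is_const_of_deriv_eq_zero (fun s => (h s).differentiableAt) (fun s => (h s).deriv) t t₀

end IsFlow

namespace IsSolution

variable {α s : ℝ} {u : ℝ → C(Torus, ℂ)}

lemma toL2_mem (hu : IsSolution α s u) (t : ℝ) : toL2 (u t) ∈ hardySubmodule :=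
  SobolevPlus.toL2_mem (hu.mem t)

lemma hasDerivAt_toHardy (hu : IsSolution α s u) (t : ℝ) :
    HasDerivAt (fun t' => toHardy (u t'))
      ((-I) • (toHardy (star (u t) * u t * u t)
        + ((α : ℂ) * inner ℂ (mode 0) (toHardy (u t))) • mode 0)) t := by
  obtain ⟨v, hv, hveq⟩ := hu.hasDerivAt t
  have h : I • v = toHardy (star (u t) * u t * u t)
      + ((α : ℂ) * inner ℂ (mode 0) (toHardy (u t))) • mode 0 := by
    rw [← toHardy_one]; exact hveq
  rw [← h, smul_smul, neg_mul, I_mul_I, neg_neg, one_smul]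
  exact hv

/-- `K_{u(t)}` is also the operator of a continuously differentiable curve of continuous symbols. -/
lemma exists_smooth_symbol (hs : 1 / 2 < s) (hu : IsSolution α s u) :
    ∃ w : ℝ → C(Torus, ℂ), (∀ t, HasDerivAt w ((-I) • (star (u t) * u t * u t)) t) ∧
      ∀ t f, shiftedHankel (u t) f = shiftedHankel (w t) f := by
  have hc := hu.continuous_uniform hs
  have hb : Continuous fun t => (-I) • (star (u t) * u t * u t) := by fun_prop
  -- The curve `u` is only known to be differentiable in `L²`, while `K` is bounded in the sup norm
  -- of its symbol. Integrating `-i |u|² u`, without `Π` and without the `α` term, gives a curve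
  -- differentiable in that norm; it differs from `u` only in modes `≤ 0`.
  set w : ℝ → C(Torus, ℂ) := fun t => u 0 + ∫ r in (0 : ℝ)..t, (-I) • (star (u r) * u r * u r)
    with hw
  have hwd : ∀ t, HasDerivAt w ((-I) • (star (u t) * u t * u t)) t := fun t =>
    (hb.integral_hasStrictDerivAt 0 t).hasDerivAt.const_add (u 0)
  refine ⟨w, hwd, fun t => shiftedHankel_congr fun n => ?_⟩
  have hd : ∀ r, HasDerivAt (fun t => inner ℂ (mode (n + 1)) (toHardy (u t) - toHardy (w t))) 0 r := by
    intro r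
    have h1 : HasDerivAt (fun t => toHardy (w t)) (toHardy ((-I) • (star (u r) * u r * u r))) r :=
      (toHardy.restrictScalars ℝ).hasFDerivAt.comp_hasDerivAt r (hwd r)
    have h2 := ((innerSL ℂ (mode (n + 1))).restrictScalars ℝ).hasFDerivAt.comp_hasDerivAt r
      ((hu.hasDerivAt_toHardy r).sub h1)
    have h3 : inner ℂ (mode (n + 1)) ((-I) • (toHardy (star (u r) * u r * u r)
        + ((α : ℂ) * inner ℂ (mode 0) (toHardy (u r))) • mode 0)
        - toHardy ((-I) • (star (u r) * u r * u r))) = 0 := by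
      rw [map_smul, ← smul_sub, add_sub_cancel_left, Hardy.inner_smul_right,
        Hardy.inner_smul_right, inner_mode_mode]
      simp
    rw [← h3]
    exact h2
  have hconst := is_const_of_deriv_eq_zero (fun r => (hd r).differentiableAt)
    (fun r => (hd r).deriv) t 0
  have hw0 : w 0 = u 0 := by simp [hw]
  rw [hw0, sub_self, inner_zero_right, inner_sub_right] at hconst
  exact sub_eq_zero.1 hconst

/-- `K_u` maps solutions of the linear equation to solutions. -/
lemma isFlow_shiftedHankel (hs : 1 / 2 < s) (hu : IsSolution α s u) {f : ℝ → Hardy}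
    (hf : IsFlow u f) : IsFlow u (fun t => shiftedHankel (u t) (f t)) := by
  obtain ⟨w, hw, hK⟩ := hu.exists_smooth_symbol hs
  intro t
  have h1 := (hankelBilin.isBoundedBilinearMap.hasFDerivAt (w t, f t)).comp_hasDerivAt t
    ((hw t).prodMk (hf t))
  have h2 : shiftedHankel (w t) (lax (u t) (f t))
      + shiftedHankel ((-I) • (star (u t) * u t * u t)) (f t)
      = lax (u t) (shiftedHankel (u t) (f t)) := by
    rw [← hK, add_comm, lax_shiftedHankel (hu.toL2_mem t)]
  have h3 : (fun t => shiftedHankel (u t) (f t)) = fun t => shiftedHankel (w t) (f t) := by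
    funext t
    rw [hK]
  rw [h3]
  change HasDerivAt _ (lax (u t) (shiftedHankel (w t) (f t))) t
  rw [← hK, ← h2]
  exact h1

/-- `K_u² f - σ² f` is again a solution of the linear equation, so its norm is constant, and it
vanishes at `t₀`. -/
lemma flow_mem_eigenK (hs : 1 / 2 < s) (hu : IsSolution α s u) {f : ℝ → Hardy}
    (hf : IsFlow u f) {σ t₀ : ℝ} (h0 : f t₀ ∈ eigenK (u t₀) σ) (t : ℝ) :
    f t ∈ eigenK (u t) σ := by
  have hflow := (hu.isFlow_shiftedHankel hs (hu.isFlow_shiftedHankel hs hf)).sub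
    (hf.smul ((σ : ℂ) ^ 2))
  have h := hflow.norm_const t t₀
  rw [mem_eigenK.1 h0, sub_self, norm_zero, norm_eq_zero] at h
  exact mem_eigenK.2 (sub_eq_zero.1 h)

/-- The flow carries an orthonormal basis of the eigenspace to an orthonormal family in the
eigenspace at time `t`. -/
lemma finrank_eigenK_le (hs : 1 / 2 < s) (hu : IsSolution α s u) {σ : ℝ} (hσ : 0 < σ)
    (t₀ t : ℝ) :
    Module.finrank ℂ (eigenK (u t₀) σ) ≤ Module.finrank ℂ (eigenK (u t) σ) := by
  have hfin := finiteDimensional_eigenK (u t₀) hσ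
  have hfin' := finiteDimensional_eigenK (u t) hσ
  let b := stdOrthonormalBasis ℂ (eigenK (u t₀) σ)
  choose f hf0 hf using fun i => IsFlow.exists_of_initial (hu.continuous_uniform hs) t₀ (b i : Hardy)
  have hmem : ∀ i, f i t ∈ eigenK (u t) σ := fun i =>
    hu.flow_mem_eigenK hs (hf i) (by rw [hf0]; exact (b i).2) t
  have horth : Orthonormal ℂ (fun i => (⟨f i t, hmem i⟩ : eigenK (u t) σ)) := by
    rw [orthonormal_iff_ite]
    intro i j
    refine ((hf i).inner_const (hf j) t t₀).trans ?_
    rw [hf0, hf0]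
    exact orthonormal_iff_ite.1 b.orthonormal i j
  have := horth.linearIndependent.fintype_card_le_finrank
  rwa [Fintype.card_fin] at this

lemma finrank_eigenK_eq (hs : 1 / 2 < s) (hu : IsSolution α s u) {σ : ℝ} (hσ : 0 < σ)
    (t₀ t : ℝ) :
    Module.finrank ℂ (eigenK (u t₀) σ) = Module.finrank ℂ (eigenK (u t) σ) :=
  le_antisymm (hu.finrank_eigenK_le hs hσ t₀ t) (hu.finrank_eigenK_le hs hσ t t₀)

/-- Orthogonality to both `u` and `1` is preserved along the flow in `F_u(σ)`. -/
lemma flow_orthogonal (hs : 1 / 2 < s) (hu : IsSolution α s u) {f : ℝ → Hardy} (hf : IsFlow u f)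
    {σ t₀ : ℝ} (h0 : f t₀ ∈ eigenK (u t₀) σ) (hu0 : inner ℂ (toHardy (u t₀)) (f t₀) = 0)
    (h10 : inner ℂ (mode 0) (f t₀) = 0) (t : ℝ) :
    inner ℂ (toHardy (u t)) (f t) = 0 ∧ inner ℂ (mode 0) (f t) = 0 := by
  set a : ℝ → ℂ := fun t => inner ℂ (mode 0) (toHardy (u t)) with ha
  have hac : Continuous a := by
    have : Continuous fun t => toHardy (u t) :=
      toHardy.continuous.comp (hu.continuous_uniform hs)
    exact (innerSL ℂ (mode 0)).continuous.comp this
  set p : ℝ → ℂ := fun t => inner ℂ (toHardy (u t)) (f t) with hp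
  set q : ℝ → ℂ := fun t => inner ℂ (mode 0) (f t) with hq
  have hK : ∀ t, shiftedHankel (u t) (shiftedHankel (u t) (f t)) = ((σ : ℂ) ^ 2) • f t := fun t =>
    mem_eigenK.1 (hu.flow_mem_eigenK hs hf h0 t)
  -- The cubic term cancels because `T_{|u|²} u = Π(|u|² u)`. What remains couples `⟨u, f⟩` to `⟨1,
  -- f⟩` through `α`; conversely `T_{|u|²} 1 = H_u u = K_u² 1 + ⟨u, 1⟩ u` couples `⟨1, f⟩` to `⟨u,
  -- f⟩`. The two scalars thus satisfy a closed linear system.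
  have hp' : ∀ t, HasDerivAt p ((I / 2 * σ ^ 2) * p t + (I * α * conj (a t)) * q t) t := by
    intro t
    have h1 := HasDerivAt.inner ℂ (hu.hasDerivAt_toHardy t) (hf t)
    have h2 : inner ℂ (toHardy (u t)) (lax (u t) (f t))
        + inner ℂ ((-I) • (toHardy (star (u t) * u t * u t)
          + ((α : ℂ) * inner ℂ (mode 0) (toHardy (u t))) • mode 0)) (f t)
        = (I / 2 * σ ^ 2) * p t + (I * α * conj (a t)) * q t := by
      have h3 : inner ℂ (toHardy (u t)) (lax (u t) (f t)) = -inner ℂ (lax (u t) (toHardy (u t))) (f t) := by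
        rw [inner_lax, neg_neg]
      have hc : ∀ x : ℂ, conj (-I * ((α : ℂ) * x)) = I * (α * conj x) := fun x => by simp
      rw [h3, lax_apply, toeplitz_toHardy (hu.toL2_mem t), inner_add_left, smul_add, inner_add_left,
        smul_smul, Hardy.inner_smul_left, Hardy.inner_smul_left, Hardy.inner_smul_left,
        inner_shiftedHankel_sq, hK, Hardy.inner_smul_right, conj_I_div_two, hc]
      simp only [map_neg, conj_I]
      ring
    rw [← h2]
    exact h1
  have hq' : ∀ t, HasDerivAt q (-(I / 2 * σ ^ 2) * q t + -(I * a t) * p t) t := by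
    intro t
    have h1 := HasDerivAt.inner ℂ (hasDerivAt_const t (mode 0)) (hf t)
    have h2 : inner ℂ (mode 0) (lax (u t) (f t)) + inner ℂ (0 : Hardy) (f t)
        = -(I / 2 * σ ^ 2) * q t + -(I * a t) * p t := by
      have h3 : inner ℂ (mode 0) (lax (u t) (f t)) = -inner ℂ (lax (u t) (mode 0)) (f t) := by
        rw [inner_lax, neg_neg]
      have h4 : hankel (u t) (toHardy (u t)) = shiftedHankel (u t) (shiftedHankel (u t) (mode 0))
          + inner ℂ (toHardy (u t)) (mode 0) • toHardy (u t) := by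
        rw [shiftedHankel_shiftedHankel, hankel_mode_zero, sub_add_cancel]
      rw [inner_zero_left, h3, lax_apply, toeplitz_mode_zero (hu.toL2_mem t), h4, inner_add_left,
        Hardy.inner_smul_left, Hardy.inner_smul_left, inner_add_left, Hardy.inner_smul_left,
        inner_conj_symm, inner_shiftedHankel_sq, hK, Hardy.inner_smul_right, conj_I_div_two,
        map_neg, conj_I]
      ring
    rw [← h2]
    exact h1
  -- A common bound for both rows: `|α|` serves the coupling in `p'`, the `1` the coupling in `q'`.
  have hk : Continuous fun t => σ ^ 2 + (|α| + 1) * ‖a t‖ := by fun_prop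
  have hz := eq_zero_of_norm_deriv_le (f := fun t => (p t, q t)) hk
    (fun t => (hp' t).prodMk (hq' t)) (fun t => ?_) (t₀ := t₀) (Prod.ext hu0 h10) t
  · exact ⟨congrArg Prod.fst hz, congrArg Prod.snd hz⟩
  have hpm : ‖p t‖ ≤ ‖(p t, q t)‖ := norm_fst_le (p t, q t)
  have hqm : ‖q t‖ ≤ ‖(p t, q t)‖ := norm_snd_le (p t, q t)
  set N := ‖(p t, q t)‖ with hN
  have hN0 : 0 ≤ N := norm_nonneg _
  have hs2 : ‖(I / 2 * (σ : ℂ) ^ 2)‖ ≤ σ ^ 2 := by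
    rw [norm_mul, norm_div, norm_I, norm_pow, Complex.norm_real, Real.norm_eq_abs, sq_abs]
    norm_num
    nlinarith [sq_nonneg σ]
  have hna : ‖I * (α : ℂ) * conj (a t)‖ = |α| * ‖a t‖ := by
    rw [norm_mul, norm_mul, norm_I, one_mul, Complex.norm_conj, Complex.norm_real,
      Real.norm_eq_abs]
  refine max_le ?_ ?_
  · calc _ ≤ ‖I / 2 * (σ : ℂ) ^ 2‖ * ‖p t‖ + ‖I * (α : ℂ) * conj (a t)‖ * ‖q t‖ := by
          refine (norm_add_le _ _).trans_eq ?_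
          rw [norm_mul _ (p t), norm_mul _ (q t)]
      _ ≤ σ ^ 2 * N + (|α| * ‖a t‖) * N := by
          rw [hna]; gcongr
      _ ≤ _ := by nlinarith [mul_nonneg (norm_nonneg (a t)) hN0]
  · calc _ ≤ ‖I / 2 * (σ : ℂ) ^ 2‖ * ‖q t‖ + ‖a t‖ * ‖p t‖ := by
          refine (norm_add_le _ _).trans_eq ?_
          rw [norm_mul _ (q t), norm_mul _ (p t), norm_neg, norm_neg, norm_mul I, norm_I, one_mul]
      _ ≤ σ ^ 2 * N + ‖a t‖ * N := by gcongr
      _ ≤ _ := by nlinarith [mul_nonneg (mul_nonneg (abs_nonneg α) (norm_nonneg (a t))) hN0]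

end IsSolution

/-! ### Transport of the structure of `F_u(σ)` along the flow -/

lemma norm_bshift_of_inner_eq_zero {f : Hardy} (h : inner ℂ (mode 0) f = 0) :
    ‖bshift f‖ = ‖f‖ := by
  rw [← norm_shift, shift_bshift_of_inner_eq_zero h]

/-- The equality case of Cauchy–Schwarz: the hypotheses give `‖f - g‖² = 0`. -/
lemma eq_of_inner_eq_norm_sq {f g : Hardy} (hn : ‖f‖ = ‖g‖) (h : inner ℂ f g = (‖f‖ : ℂ) ^ 2) :
    f = g := by
  rw [← sub_eq_zero, ← norm_eq_zero, ← sq_eq_zero_iff, @norm_sub_sq ℂ, h, ← hn, ← ofReal_pow]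
  change _ - 2 * (((‖f‖ ^ 2 : ℝ) : ℂ)).re + _ = (0 : ℝ)
  rw [ofReal_re]
  ring

/-- A vector of `F_u(σ)` orthogonal to `z w, …, z ^ n w` is proportional to `u'_σ`. -/
lemma IsChain.projK_eq_smul {u : C(Torus, ℂ)} {σ : ℝ} {w : Hardy} (hw : IsChain u σ w)
    (hσ : 0 < σ) {n : ℕ} (hn : Module.finrank ℂ (eigenK u σ) = n + 1) (hv : projK u σ ≠ 0)
    {Q : Polynomial ℂ} (hQ : Q.natDegree ≤ n) (hQ0 : Q.coeff 0 ≠ 0)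
    (horth : ∀ j, 0 < j → j ≤ n → inner ℂ ((shift ^ j) w) (Polynomial.aeval shift Q w) = 0) :
    ∃ c : ℂ, c ≠ 0 ∧ projK u σ = c • Polynomial.aeval shift Q w := by
  set x := Polynomial.aeval shift Q w with hx
  have hQne : Q ≠ 0 := by
    rintro rfl
    exact hQ0 (Polynomial.coeff_zero 0)
  have hx0 : inner ℂ x x ≠ 0 := inner_self_ne_zero.2 (aeval_shift_ne_zero hQne hw.ne_zero)
  -- With this `c`, the difference `y` is orthogonal to `x` and to `z w, …, z^n w`. Since `x` has a
  -- nonzero coefficient on `w`, also `y ⊥ w`; but `y` lies in the span of the chain, so `y = 0`.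
  set c : ℂ := inner ℂ x (projK u σ) / inner ℂ x x with hc
  set y := projK u σ - c • x with hy
  have hxy : inner ℂ x y = 0 := by
    rw [hy, inner_sub_right, Hardy.inner_smul_right, hc, div_mul_cancel₀ _ hx0, sub_self]
  have hjy : ∀ j, 0 < j → j ≤ n → inner ℂ ((shift ^ j) w) y = 0 := by
    intro j hj0 hj
    rw [hy, inner_sub_right, Hardy.inner_smul_right, horth j hj0 hj, ← inner_conj_symm,
      inner_projK (hw.mem j (by omega)), hw.orth j hj0 (by omega), map_zero, mul_zero, sub_zero]
  have hsum : ∀ R : Polynomial ℂ, R.natDegree ≤ n →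
      inner ℂ (Polynomial.aeval shift R w) y = conj (R.coeff 0) * inner ℂ w y := by
    intro R hR
    rw [aeval_apply_eq_sum (Nat.lt_succ_of_le hR), sum_inner, Finset.sum_eq_single 0]
    · rw [Hardy.inner_smul_left]; rfl
    · intro j hj hj0
      rw [Hardy.inner_smul_left, hjy j (Nat.pos_of_ne_zero hj0)
        (Nat.lt_succ_iff.1 (Finset.mem_range.1 hj)), mul_zero]
    · intro h
      exact absurd (Finset.mem_range.2 (Nat.succ_pos n)) h
  have hwy : inner ℂ w y = 0 := by
    rw [hx, hsum Q hQ] at hxy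
    exact (mul_eq_zero.1 hxy).resolve_left ((map_ne_zero _).2 hQ0)
  have hmem : y ∈ eigenK u σ := by
    refine Submodule.sub_mem _ (projK_mem u σ) (Submodule.smul_mem _ _ ?_)
    rw [hx, aeval_apply_eq_sum (Nat.lt_succ_of_le hQ)]
    exact Submodule.sum_mem _ fun i hi =>
      Submodule.smul_mem _ _ (hw.mem i (by rw [hn]; exact Finset.mem_range.1 hi))
  obtain ⟨R, hR, hyR⟩ := hw.exists_polynomial hσ (by omega) hmem
  have hyy : inner ℂ y y = 0 := by
    have h1 := hsum R (by omega)
    rwa [← hyR, hwy, mul_zero] at h1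
  have hy0 : y = 0 := inner_self_eq_zero.1 hyy
  have hvx : projK u σ = c • x := sub_eq_zero.1 hy0
  exact ⟨c, fun h => hv (by rw [hvx, h, zero_smul]), hvx⟩

namespace IsSolution

variable {α s : ℝ} {u : ℝ → C(Torus, ℂ)}

/-- The Lax flow maps chains to chains and preserves their inner products. -/
lemma exists_isChain_transport (hs : 1 / 2 < s) (hu : IsSolution α s u) {σ : ℝ} (hσ : 0 < σ)
    {t₀ : ℝ} (hv : projK (u t₀) σ ≠ 0) {w : Hardy} (hw : IsChain (u t₀) σ w) (t : ℝ) :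
    ∃ w', IsChain (u t) σ w' ∧ ∀ i j, i < Module.finrank ℂ (eigenK (u t₀) σ) →
      j < Module.finrank ℂ (eigenK (u t₀) σ) →
      inner ℂ ((shift ^ i) w') ((shift ^ j) w') = inner ℂ ((shift ^ i) w) ((shift ^ j) w) := by
  have hfr := hu.finrank_eigenK_eq hs hσ t₀ t
  set m := Module.finrank ℂ (eigenK (u t₀) σ) with hm
  have hpos : 0 < m := by
    have hfin := finiteDimensional_eigenK (u t₀) hσ
    rw [Nat.pos_iff_ne_zero]
    intro h0
    exact hv ((Submodule.eq_bot_iff _).1 (Submodule.finrank_eq_zero.1 h0) _ (projK_mem _ σ))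
  choose f hf0 hf using fun j : ℕ =>
    IsFlow.exists_of_initial (hu.continuous_uniform hs) t₀ ((shift ^ j) w)
  have hmem : ∀ j < m, ∀ r, f j r ∈ eigenK (u r) σ := fun j hj r =>
    hu.flow_mem_eigenK hs (hf j) (by rw [hf0]; exact hw.mem j hj) r
  have horth : ∀ j, 0 < j → j < m → ∀ r, inner ℂ (toHardy (u r)) (f j r) = 0 ∧
      inner ℂ (mode 0) (f j r) = 0 := by
    intro j hj0 hj r
    have h0 : f j t₀ ∈ eigenK (u t₀) σ := hmem j hj t₀
    have h1 : inner ℂ (toHardy (u t₀)) (f j t₀) = 0 := by rw [hf0]; exact hw.orth j hj0 hj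
    -- Only at `t₀` is `u'_σ ≠ 0` used, to get orthogonality to `1` from orthogonality to `u`;
    -- afterwards the two propagate together.
    exact hu.flow_orthogonal hs (hf j) h0 h1 (bshift_mem_eigenK hσ hv h0 h1).1 r
  have hnorm : ∀ j, ‖f j t‖ = ‖w‖ := fun j => by
    rw [(hf j).norm_const t t₀, hf0, norm_shift_pow]
  have hstep : ∀ j, j + 1 < m → f (j + 1) t = shift (f j t) := by
    intro j hj
    have hz := horth (j + 1) (Nat.succ_pos j) hj
    have h1 := (hf (j + 1)).inner_bshift_const (hf j) (fun r => (hz r).2) (fun r => (hz r).1) t t₀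
    -- The vectors `f_j` and `S* f_(j+1)` have norm `‖w‖`, and their inner product is constant along
    -- the flow; at `t₀` it equals `‖w‖²`.
    have h2 : f j t = bshift (f (j + 1) t) := by
      apply eq_of_inner_eq_norm_sq
      · rw [norm_bshift_of_inner_eq_zero (hz t).2, hnorm, hnorm]
      · rw [h1, hf0, hf0, shift_pow_succ_apply, bshift_shift, hnorm, ← norm_shift_pow j w]
        exact inner_self_eq_norm_sq_to_K _
    rw [h2, shift_bshift_of_inner_eq_zero (hz t).2]
  have hpow : ∀ j < m, f j t = (shift ^ j) (f 0 t) := by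
    intro j
    induction j with
    | zero => exact fun _ => rfl
    | succ j ih =>
      intro hj
      rw [hstep j hj, ih (by omega), shift_pow_succ_apply]
  refine ⟨f 0 t, ⟨?_, ?_, ?_⟩, ?_⟩
  · rw [← norm_ne_zero_iff, hnorm, norm_ne_zero_iff]
    exact hw.ne_zero
  · intro j hj
    rw [← hfr] at hj
    rw [← hpow j hj]
    exact hmem j hj t
  · intro j hj0 hj
    rw [← hfr] at hj
    rw [← hpow j hj]
    exact (horth j hj0 hj t).1
  · intro i j hi hj
    rw [← hpow i hi, ← hpow j hj, (hf i).inner_const (hf j) t t₀, hf0, hf0]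

/-- The monic polynomial of the Blaschke factor is the same at all times. -/
lemma blaschkeFactor_P_eq (hs : 1 / 2 < s) (hu : IsSolution α s u) {σ : ℝ} (hσ : 0 < σ)
    {t₀ t : ℝ} (hv₀ : projK (u t₀) σ ≠ 0) (hv : projK (u t) σ ≠ 0) {Ψ₀ Ψ : BlaschkeProduct}
    (h₀ : IsBlaschkeFactor (u t₀) σ Ψ₀) (h : IsBlaschkeFactor (u t) σ Ψ) : Ψ.P = Ψ₀.P := by
  obtain ⟨w, n, Q, Φ₀, hw, hn, hQ, hQ0, hQv, hΦ₀, -, hP₀⟩ := exists_isBlaschkeFactor hσ hv₀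
  obtain ⟨w', hw', hin⟩ := hu.exists_isChain_transport hs hσ hv₀ hw t
  have hn' : Module.finrank ℂ (eigenK (u t) σ) = n + 1 := by
    rw [← hu.finrank_eigenK_eq hs hσ t₀ t, hn]
  rw [hn] at hin
  -- These inner products involve only the Gram matrix of the chain, so the orthogonality known at
  -- `t₀` holds at `t` with the same `Q`.
  have horth : ∀ j, 0 < j → j ≤ n →
      inner ℂ ((shift ^ j) w') (Polynomial.aeval shift Q w') = 0 := by
    intro j hj0 hj
    have h1 : inner ℂ ((shift ^ j) w') (Polynomial.aeval shift Q w')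
        = inner ℂ ((shift ^ j) w) (Polynomial.aeval shift Q w) := by
      rw [aeval_apply_eq_sum (Nat.lt_succ_of_le hQ), aeval_apply_eq_sum (Nat.lt_succ_of_le hQ),
        inner_sum, inner_sum]
      refine Finset.sum_congr rfl fun i hi => ?_
      rw [Hardy.inner_smul_right, Hardy.inner_smul_right,
        hin j i (by omega) (Finset.mem_range.1 hi)]
    rw [h1, ← hQv, ← inner_conj_symm, inner_projK (hw.mem j (by omega)),
      hw.orth j hj0 (by omega), map_zero]
  obtain ⟨c, hc, hcv⟩ := hw'.projK_eq_smul hσ hn' hv hQ hQ0 horth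
  have hcQ : projK (u t) σ = Polynomial.aeval shift (Polynomial.C c * Q) w' := by
    rw [aeval_mul_apply, aeval_C_apply, hcv]
  obtain ⟨Φ, hΦ, -, hP⟩ := hw'.exists_blaschkeFactor hσ hn'
    ((Polynomial.natDegree_C_mul_le c Q).trans hQ) hcQ hv
  -- Replacing `Q` by `c Q` does not change the monic polynomial: the factor `c̄` of the reflection
  -- cancels in the normalisation.
  rw [h.unique hσ hv hΦ, h₀.unique hσ hv₀ hΦ₀, hP, hP₀, Polynomial.coeff_C_mul,
    Polynomial.map_mul, Polynomial.map_C, Polynomial.reflect_C_mul, ← mul_assoc,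
    ← Polynomial.C_mul, map_mul (starRingEnd ℂ), mul_inv, mul_right_comm,
    inv_mul_cancel₀ ((map_ne_zero _).2 hc), one_mul]

/-- The dimension of `F_u(σ)` is constant and positive at `t₀`; if `u'_σ` vanished at `t`, then `t`
would be a crossing time. -/
lemma projK_ne_zero_of_not_crossing (hs : 1 / 2 < s) (hu : IsSolution α s u) {σ : ℝ} (hσ : 0 < σ)
    {t₀ t : ℝ} (hv₀ : projK (u t₀) σ ≠ 0) (ht : t ∉ crossingTimes u σ) : projK (u t) σ ≠ 0 := by
  intro hv
  refine ht (crossing_of_projK_eq_zero hσ hv fun hF => ?_)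
  have hfin := finiteDimensional_eigenK (u t₀) hσ
  have h1 := hu.finrank_eigenK_eq hs hσ t₀ t
  rw [hF, finrank_bot] at h1
  exact hv₀ ((Submodule.eq_bot_iff _).1 (Submodule.finrank_eq_zero.1 h1) _ (projK_mem _ σ))

end IsSolution

/-- Two Blaschke products with the same monic polynomial differ by a rotation. -/
lemma BlaschkeProduct.eval_eq_exp_mul {Ψ Ψ₀ : BlaschkeProduct} (h : Ψ.P = Ψ₀.P) (z : ℂ) :
    Ψ.eval z = Complex.exp (Complex.I * ((Ψ₀.angle - Ψ.angle).toReal : ℝ)) * Ψ₀.eval z := by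
  have h1 : ((-Ψ.angle).toCircle : ℂ)
      = Complex.exp (Complex.I * ((Ψ₀.angle - Ψ.angle).toReal : ℝ)) * ((-Ψ₀.angle).toCircle : ℂ) := by
    rw [mul_comm I, ← Circle.coe_exp, ← Real.Angle.toCircle_coe, Real.Angle.coe_toReal,
      ← Circle.coe_mul, ← Real.Angle.toCircle_add, sub_add_eq_add_sub, add_neg_cancel, zero_sub]
  have hD : Ψ.D = Ψ₀.D := by rw [D, D, h]
  rw [eval, eval, h1, h, hD, mul_assoc]

end AlphaSzego

theorem proposition4p5 (α s : ℝ) (hs : 1 / 2 < s) (u : ℝ → C(AlphaSzego.Torus, ℂ))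
    (hu : AlphaSzego.IsSolution α s u) (σ : ℝ) (hσ : 0 < σ) :
    -- the Blaschke product is well defined at every time at which `σ ∈ Σ_K(u(t))`
    (∀ t : ℝ, σ ∈ AlphaSzego.SigmaK (u t) →
      ∃ Ψ : AlphaSzego.BlaschkeProduct,
        AlphaSzego.IsBlaschkeFactor (u t) σ Ψ ∧
        Ψ.degree + 1 = Module.finrank ℂ (AlphaSzego.eigenK (u t) σ) ∧
        ∀ Ψ' : AlphaSzego.BlaschkeProduct,
          AlphaSzego.IsBlaschkeFactor (u t) σ Ψ' → Ψ' = Ψ) ∧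
    ∀ Ψ : ℝ → AlphaSzego.BlaschkeProduct,
      (∀ t : ℝ, σ ∈ AlphaSzego.SigmaK (u t) → AlphaSzego.IsBlaschkeFactor (u t) σ (Ψ t)) →
      -- rotation on every open interval which avoids the crossing times
      (∀ Ω : Set ℝ, IsOpen Ω → Ω.OrdConnected →
        (∀ t ∈ Ω, t ∉ AlphaSzego.crossingTimes u σ) →
        (∃ t ∈ Ω, σ ∈ AlphaSzego.SigmaK (u t)) →
        (∀ t ∈ Ω, σ ∈ AlphaSzego.SigmaK (u t)) ∧
        ∀ t₀ ∈ Ω, ∃ ψ : ℝ → ℝ, ∀ t ∈ Ω, ∀ z : ℂ, ‖z‖ ≤ 1 →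
          (Ψ t).eval z = Complex.exp (Complex.I * ψ t) * (Ψ t₀).eval z) ∧
      -- the zeros are the same at all times, also on the two sides of a crossing
      (∀ t t' : ℝ, σ ∈ AlphaSzego.SigmaK (u t) → σ ∈ AlphaSzego.SigmaK (u t') →
        (Ψ t).zeros = (Ψ t').zeros) := by
  have hiff : ∀ t, σ ∈ AlphaSzego.SigmaK (u t) ↔ AlphaSzego.projK (u t) σ ≠ 0 := fun t =>
    AlphaSzego.mem_SigmaK_iff hσ
  refine ⟨fun t ht => ?_, fun Ψ hΨ => ?_⟩
  · obtain ⟨-, n, -, Ψ, -, hn, -, -, -, hΨ, hdeg, -⟩ :=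
      AlphaSzego.exists_isBlaschkeFactor hσ ((hiff t).1 ht)
    exact ⟨Ψ, hΨ, by rw [hdeg, hn], fun Ψ' h' => h'.unique hσ ((hiff t).1 ht) hΨ⟩
  have hP : ∀ t t', σ ∈ AlphaSzego.SigmaK (u t) → σ ∈ AlphaSzego.SigmaK (u t') →
      (Ψ t).P = (Ψ t').P := fun t t' ht ht' =>
    hu.blaschkeFactor_P_eq hs hσ ((hiff t').1 ht') ((hiff t).1 ht) (hΨ t' ht') (hΨ t ht)
  refine ⟨fun Ω _ _ hΩ hex => ?_, fun t t' ht ht' => congrArg Polynomial.roots (hP t t' ht ht')⟩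
  obtain ⟨t₁, -, ht₁⟩ := hex
  have hall : ∀ t ∈ Ω, σ ∈ AlphaSzego.SigmaK (u t) := fun t ht =>
    (hiff t).2 (hu.projK_ne_zero_of_not_crossing hs hσ ((hiff t₁).1 ht₁) (hΩ t ht))
  refine ⟨hall, fun t₀ ht₀ => ⟨fun t => ((Ψ t₀).angle - (Ψ t).angle).toReal, fun t ht z _ => ?_⟩⟩
  exact AlphaSzego.BlaschkeProduct.eval_eq_exp_mul (hP t t₀ (hall t ht) (hall t₀ ht₀)) z
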